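/- Let $\mathbf H$ be a random $2\times2$ complex matrix with independent entries $\mathbf H_{ij}\sim\mathcal{CN}(0,\phi_{ij})$, $\phi_{ij}>0$ (circularly symmetric complex Gaussians: independent real and imaginary parts, each $\mathcal N(0,\phi_{ij}/2)$). Write $\mathbf W=\mathbf H\mathbf H^\dagger=\begin{pmatrix}w_1&w_3\\ w_3^*&w_2\end{pmatrix}\succeq 0$, $K=\prod_{i,j=1}^{2}\frac1{\phi_{ij}}$, $s_i=\frac1{\phi_{i1}}+\frac1{\phi_{i2}}$, $\epsilon_i=\frac1{\phi_{i1}}-\frac1{\phi_{i2}}$. Suppose $\phi_{21}=\phi_{22}=:\phi_3$ and put $\phi_1=\min(\phi_{11},\phi_{12})$, $\phi_2=\max(\phi_{11},\phi_{12})$, with $\phi_1\ne\phi_2$. Let $\mathrm{Ei}(x)=-\int_{-x}^{\infty}\frac{e^{-t}}{t}\,dt$ for $x\neq0$ (Cauchy principal value at $t=0$ if $x>0$) and $$g(x)=\mathrm{Ei}\big((1/\phi_3-1/\phi_2)x\big)-\mathrm{Ei}\big((1/\phi_3-1/\phi_1)x\big).$$ (a) $\mathbf W$ has the probability density (with respect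 to $dw_1\,dw_2\,d\Re w_3\,d\Im w_3$) $$p(\mathbf W)=\frac K\pi\, e^{-\frac12(w_1s_1+w_2s_2)}\,\frac{\sinh\left(\frac12 w_1|\epsilon_1|\right)}{\frac12 w_1|\epsilon_1|}$$ on the set of positive semidefinite matrices, and $0$ elsewhere. (b) The ordered eigenvalues $\lambda_1\ge\lambda_2>0$ of $\mathbf W$ have the joint probability density $$p(\lambda_1,\lambda_2)=\frac{e^{-(\lambda_1+\lambda_2)/\phi_3}}{(\phi_2-\phi_1)\phi_3^2}\,\det\left(\lambda_i^{j-1}\right)_{i,j=1,2}\,\det\left(g(\lambda_j)^{i-1}\right)_{i,j=1,2}$$ on $\lambda_1\ge\lambda_2>0$. This holds literally if $\phi_3\notin\{\phi_1,\phi_2\}$; if $\phi_3\in\{\phi_1,\phi_2\}$, where $g$ itself is not defined, it holds with the last determinant replaced by its limit as the parameter $\phi_3$ in $g$ tends to the given value through values different from $\phi_1,\phi_2$ (this limit exists). (c) If $\phi_1,\phi_2,\phi_3$ are all distinct then, for every $x>0$, $$\mathbb P(\lambda_{\min}\le x)=1-\frac{e^{-x/\phi_3}}{\phi_2-\phi_1}\Big(\phi_2e^{-x/\phi_2}-\phi_1e^{-x/\phi_1}+x\big(\mathrm{Ei}(-x/\phi_2)-\mathrm{Ei}(-x/\phi_1)\big)\Big),$$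 $$\mathbb P(\lambda_{\max}\le x)=\frac1{\phi_2-\phi_1}\Big((1-e^{-x/\phi_3})\big(\phi_2(1-e^{-x/\phi_2})-\phi_1(1-e^{-x/\phi_1})\big)+xe^{-x/\phi_3}\Big(-g(x)+\mathrm{Ei}(-x/\phi_2)-\mathrm{Ei}(-x/\phi_1)+\log\Big|\frac{\phi_3-\phi_2}{\phi_3-\phi_1}\Big|\Big)\Big),$$ and both probabilities are $0$ for $x\le0$. -/

import Mathlib

open MeasureTheory ProbabilityTheory Set Filter Topology
open scoped ComplexOrder

noncomputable section

/-- The circularly symmetric complex Gaussian law `𝒞𝒩(0, v)`: the real and the imaginary part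
are independent real centered Gaussians of variance `v / 2`. -/
def complexGaussian (v : ℝ) : Measure ℂ :=
  ((gaussianReal 0 (v / 2).toNNReal).prod (gaussianReal 0 (v / 2).toNNReal)).map
    (fun p : ℝ × ℝ => (⟨p.1, p.2⟩ : ℂ))

/-- `X` admits the probability density function `f` with respect to the measure `μ`. -/
def HasDensity {Ω E : Type*} [MeasurableSpace Ω] [MeasurableSpace E]
    (X : Ω → E) (P : Measure Ω) (μ : Measure E) (f : E → ℝ) : Prop :=
  AEMeasurable X P ∧ (∀ x, 0 ≤ f x) ∧ AEMeasurable f μ ∧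
    P.map X = μ.withDensity (fun x => ENNReal.ofReal (f x))

/-- Complex matrices carry the product σ-algebra of their entries. -/
instance matrixMeasurableSpace : MeasurableSpace (Matrix (Fin 2) (Fin 2) ℂ) :=
  inferInstanceAs (MeasurableSpace (Fin 2 → Fin 2 → ℂ))

/-- The Hermitian matrix with diagonal entries `w₁`, `w₂` and upper off-diagonal entry `w₃`. -/
def hermitianOfEntries (w : ℝ × ℝ × ℂ) : Matrix (Fin 2) (Fin 2) ℂ :=
  !![(w.1 : ℂ), w.2.2; star w.2.2, (w.2.1 : ℂ)]

/-- The Lebesgue measure `dw₁ dw₂ d(Re w₃) d(Im w₃)` of the space of `2 × 2` Hermitian matrices,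
as a measure on all `2 × 2` complex matrices. -/
def hermitianVolume : Measure (Matrix (Fin 2) (Fin 2) ℂ) :=
  (volume : Measure (ℝ × ℝ × ℂ)).map hermitianOfEntries

/-- The Gram matrix `H Hᴴ`. -/
def gram (H : Matrix (Fin 2) (Fin 2) ℂ) : Matrix (Fin 2) (Fin 2) ℂ :=
  H * H.conjTranspose

theorem gram_isHermitian (H : Matrix (Fin 2) (Fin 2) ℂ) : (gram H).IsHermitian :=
  Matrix.isHermitian_mul_conjTranspose_self H

/-- The larger eigenvalue of `H Hᴴ`. -/
def eigMax (H : Matrix (Fin 2) (Fin 2) ℂ) : ℝ :=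
  max ((gram_isHermitian H).eigenvalues 0) ((gram_isHermitian H).eigenvalues 1)

/-- The smaller eigenvalue of `H Hᴴ`. -/
def eigMin (H : Matrix (Fin 2) (Fin 2) ℂ) : ℝ :=
  min ((gram_isHermitian H).eigenvalues 0) ((gram_isHermitian H).eigenvalues 1)

/-- The exponential integral `Ei x = - ∫_{-x}^∞ e^{-t} / t dt`, for `x ≠ 0`, where the integral is
a Cauchy principal value at `t = 0` (which matters only for `x > 0`). -/
def Ei (x : ℝ) : ℝ :=
  - limUnder (𝓝[>] (0 : ℝ))
      (fun δ : ℝ => ∫ t in {t : ℝ | -x < t ∧ δ < |t|}, Real.exp (-t) / t)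

/-- `K = ∏ 1 / φᵢⱼ`. -/
def profileK (φ : Fin 2 → Fin 2 → ℝ) : ℝ := ∏ i, ∏ j, 1 / φ i j

/-- `sᵢ = 1 / φᵢ₁ + 1 / φᵢ₂`. -/
def profileS (φ : Fin 2 → Fin 2 → ℝ) (i : Fin 2) : ℝ := 1 / φ i 0 + 1 / φ i 1

/-- `εᵢ = 1 / φᵢ₁ - 1 / φᵢ₂`. -/
def profileEps (φ : Fin 2 → Fin 2 → ℝ) (i : Fin 2) : ℝ := 1 / φ i 0 - 1 / φ i 1

/-- The density of `W = (w₁, w₃; w₃*, w₂)`, supported on the positive semidefinite matrices. -/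
def gramDensity (φ : Fin 2 → Fin 2 → ℝ) : Matrix (Fin 2) (Fin 2) ℂ → ℝ :=
  {W | W.PosSemidef}.indicator fun W =>
    profileK φ / Real.pi *
      Real.exp (-(1 / 2) * ((W 0 0).re * profileS φ 0 + (W 1 1).re * profileS φ 1)) *
      (Real.sinh ((1 / 2) * (W 0 0).re * |profileEps φ 0|) /
        ((1 / 2) * (W 0 0).re * |profileEps φ 0|))

/-- `g(x) = Ei((1/φ₃ - 1/φ₂) x) - Ei((1/φ₃ - 1/φ₁) x)`. -/
def gFun (φ₁ φ₂ φ₃ x : ℝ) : ℝ :=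
  Ei ((1 / φ₃ - 1 / φ₂) * x) - Ei ((1 / φ₃ - 1 / φ₁) * x)

/-- `det (λᵢ^{j-1})`. -/
def detPow (l : Fin 2 → ℝ) : ℝ :=
  (Matrix.of fun i j : Fin 2 => l i ^ (j : ℕ)).det

/-- `det (g(λⱼ)^{i-1})`. -/
def detG (φ₁ φ₂ φ₃ : ℝ) (l : Fin 2 → ℝ) : ℝ :=
  (Matrix.of fun i j : Fin 2 => gFun φ₁ φ₂ φ₃ (l j) ^ (i : ℕ)).det

/-- The function
`e^{-(λ₁+λ₂)/φ₃} / ((φ₂-φ₁) φ₃²) * det (λᵢ^{j-1}) * D(λ₁, λ₂)` on `λ₁ ≥ λ₂ > 0`,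
and zero elsewhere. -/
def eigDensity (φ₁ φ₂ φ₃ : ℝ) (D : (Fin 2 → ℝ) → ℝ) : ℝ × ℝ → ℝ :=
  {l : ℝ × ℝ | l.2 ≤ l.1 ∧ 0 < l.2}.indicator fun l =>
    Real.exp (-(l.1 + l.2) / φ₃) / ((φ₂ - φ₁) * φ₃ ^ 2) *
      detPow ![l.1, l.2] * D ![l.1, l.2]

end

/-!
The argument is a sequence of explicit changes of variables, carried out for the integrals
`∫⁻ ω, f (…) ∂P` of arbitrary measurable functions `f ≥ 0`.

*Density of `W = H Hᴴ`.* Since the second row of `H` is isotropic, conditionally on the first row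
`(a, b)` its distribution seen by `w₃ = a c̄ + b d̄` and `w₂ = |c|² + |d|²` depends only on
`w₁ = |a|² + |b|²`: substituting `u = a c̄ + b d̄` for `c` and completing the square in `d` gives
`w₂ = s + |u|² / w₁` with `s` proportional to a squared modulus, so that `(u, s)` has Lebesgue
measure up to a factor (`lintegral_comp_sumSq_bilin`). As `w₁` is the sum of two independent
exponential variables, its density is a divided difference of two exponentials
(`lintegral_sum_normSq_complexGaussian`). Together these give the law of `(w₁, w₂, w₃)`
(`lintegral_gramEntries`).

*Eigenvalues.* For fixed `w₁ = w`, the pair `(w₂, |w₃|²)` is mapped to the eigenvalues `(x, y)`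
bijectively onto `y < w < x` with Jacobian `x - y` (`lintegral_comp_eigenvalues`). Hence all
statements on the eigenvalues are integrals over triples `y < w < x` of
`κ(w) / w * (x - y) e^{-(x + y - w) / φ₃} / φ₃²`, where `κ` is the density of `w₁`
(`lintegral_eigenvalues`). Integrating over `w` first gives the joint density, since
`κ(w) e^{w / φ₃} / w` is a multiple of the derivative of `g`; integrating over `y` and `x` first
and over `w` last gives the distribution functions.

*Exponential integral.* All that is used about the principal value `Ei` is that
`Ei x = C + log |x| + ∫₀ˣ (e^t - 1) / t dt` for `x ≠ 0` and some constant `C` (`Ei_eq`), and that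
`Ei x → 0` as `x → -∞`. The integral on the right is entire, so replacing `Ei` by it in `g` changes
`g` by a constant in `x` only, which cancels in the determinant, and extends the determinant
continuously to `φ₃ ∈ {φ₁, φ₂}`. In the distribution function of the larger eigenvalue the
logarithms are what remains of this constant.
-/

/-! ### Fundamental theorem of calculus and substitutions for lower Lebesgue integrals -/

/-- The integral of a nonnegative derivative over an interval; integrability is automatic. -/
theorem setLIntegral_Ioo_ofReal_deriv {F F' : ℝ → ℝ} {a b : ℝ} (hab : a ≤ b)
    (hcont : ContinuousOn F (Icc a b)) (hderiv : ∀ x ∈ Ioo a b, HasDerivAt F (F' x) x)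
    (hnn : ∀ x ∈ Ioo a b, 0 ≤ F' x) :
    0 ≤ F b - F a ∧ ∫⁻ x in Ioo a b, ENNReal.ofReal (F' x) = ENNReal.ofReal (F b - F a) := by
  have hint := intervalIntegral.integrableOn_deriv_of_nonneg hcont hderiv hnn
  rw [← intervalIntegral.integral_eq_sub_of_hasDerivAt_of_le hab hcont hderiv
    ((intervalIntegrable_iff_integrableOn_Ioc_of_le hab).2 hint),
    intervalIntegral.integral_of_le hab, integral_Ioc_eq_integral_Ioo]
  exact ⟨setIntegral_nonneg measurableSet_Ioo hnn,
    (ofReal_integral_eq_lintegral_ofReal (hint.mono_set Ioo_subset_Ioc_self)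
      ((ae_restrict_mem measurableSet_Ioo).mono hnn)).symm⟩

theorem setLIntegral_Ioi_ofReal_deriv {F F' : ℝ → ℝ} {a l : ℝ}
    (hderiv : ∀ x ∈ Ici a, HasDerivAt F (F' x) x) (hnn : ∀ x ∈ Ioi a, 0 ≤ F' x)
    (hlim : Tendsto F atTop (𝓝 l)) :
    0 ≤ l - F a ∧ ∫⁻ x in Ioi a, ENNReal.ofReal (F' x) = ENNReal.ofReal (l - F a) := by
  rw [← integral_Ioi_of_hasDerivAt_of_nonneg' hderiv hnn hlim]
  exact ⟨setIntegral_nonneg measurableSet_Ioi hnn,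
    (ofReal_integral_eq_lintegral_ofReal (integrableOn_Ioi_deriv_of_nonneg' hderiv hnn hlim)
      ((ae_restrict_mem measurableSet_Ioi).mono hnn)).symm⟩

@[fun_prop]
theorem measurable_normSq : Measurable (fun z : ℂ => Complex.normSq z) :=
  Complex.continuous_normSq.measurable

theorem lintegral_comp_mul_add (f : ℝ → ENNReal) {c : ℝ} (hc : c ≠ 0) (d : ℝ) :
    ∫⁻ x, f (c * x + d) = ENNReal.ofReal |c⁻¹| * ∫⁻ y, f y := by
  have himg : (fun x : ℝ => c⁻¹ * (x - d)) '' univ = univ := by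
    rw [image_univ, range_eq_univ]
    intro y
    exact ⟨c * y + d, by field_simp; ring⟩
  have hinj : InjOn (fun x : ℝ => c⁻¹ * (x - d)) univ := fun x _ y _ h => by
    have := mul_left_cancel₀ (inv_ne_zero hc) h
    linarith
  have h := lintegral_image_eq_lintegral_abs_deriv_mul (s := univ)
    (f := fun x : ℝ => c⁻¹ * (x - d)) (f' := fun _ => c⁻¹) MeasurableSet.univ
    (fun x _ => (by simpa using ((hasDerivAt_id x).sub_const d).const_mul c⁻¹ :
      HasDerivAt (fun x : ℝ => c⁻¹ * (x - d)) c⁻¹ x).hasDerivWithinAt) hinj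
    (fun x => f (c * x + d))
  rw [himg, setLIntegral_univ, setLIntegral_univ, lintegral_const_mul' _ _ (by simp)] at h
  rw [h]
  congr 2
  funext x
  congr 1
  field_simp
  ring

/-- The substitution `σ = r² - q²`. -/
theorem setLIntegral_Ioi_comp_sqrt (G : ℝ → ENNReal) (q : ℝ) :
    ∫⁻ σ in Ioi 0, G √(q ^ 2 + σ) = ∫⁻ r in Ioi |q|, ENNReal.ofReal (2 * r) * G r := by
  have himg : (fun r : ℝ => r ^ 2 - q ^ 2) '' Ioi |q| = Ioi 0 := by
    ext σ
    simp only [mem_image, mem_Ioi]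
    constructor
    · rintro ⟨r, hr, rfl⟩
      have := sq_lt_sq.2 (hr.trans_le (le_abs_self r))
      linarith
    · intro hσ
      refine ⟨√(q ^ 2 + σ), ?_, ?_⟩
      · rw [← Real.sqrt_sq_eq_abs]
        exact Real.sqrt_lt_sqrt (sq_nonneg q) (by linarith)
      · rw [Real.sq_sqrt (by positivity)]
        ring
  have hpos : ∀ r ∈ Ioi |q|, 0 < r := fun r hr => (abs_nonneg q).trans_lt hr
  have hinj : InjOn (fun r : ℝ => r ^ 2 - q ^ 2) (Ioi |q|) := fun x hx y hy h => by
    have h' : x ^ 2 = y ^ 2 := by simpa using h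
    exact (pow_left_inj₀ (hpos x hx).le (hpos y hy).le two_ne_zero).1 h'
  have h := lintegral_image_eq_lintegral_abs_deriv_mul (s := Ioi |q|)
    (f := fun r : ℝ => r ^ 2 - q ^ 2) (f' := fun r => 2 * r) measurableSet_Ioi
    (fun x _ => (by simpa using ((hasDerivAt_pow 2 x).sub_const (q ^ 2)) :
      HasDerivAt (fun r : ℝ => r ^ 2 - q ^ 2) (2 * x) x).hasDerivWithinAt) hinj
    (fun σ => G √(q ^ 2 + σ))
  rw [himg] at h
  rw [h]
  refine setLIntegral_congr_fun measurableSet_Ioi fun r hr => ?_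
  have hr0 := hpos r hr
  rw [abs_of_pos (by positivity), add_sub_cancel, Real.sqrt_sq hr0.le]

/-- Polar coordinates: under Lebesgue measure on `ℂ`, the squared modulus is distributed as
`π` times Lebesgue measure on `(0, ∞)`. -/
theorem lintegral_comp_normSq {G : ℝ → ENNReal} (hG : Measurable G) :
    ∫⁻ z : ℂ, G (Complex.normSq z) = ENNReal.ofReal Real.pi * ∫⁻ s in Ioi 0, G s := by
  have h2 := setLIntegral_Ioi_comp_sqrt (fun r => G (r ^ 2)) 0
  have h3 : ∫⁻ s in Ioi (0 : ℝ), G (√(0 ^ 2 + s) ^ 2) = ∫⁻ s in Ioi 0, G s :=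
    setLIntegral_congr_fun measurableSet_Ioi fun s hs => by
      rw [Real.sq_sqrt (by simpa using (le_of_lt hs)), zero_pow two_ne_zero, zero_add]
  rw [← Complex.lintegral_comp_polarCoord_symm, ← h3, h2]
  simp only [Complex.normSq_eq_norm_sq, Complex.norm_polarCoord_symm, sq_abs, polarCoord_target,
    smul_eq_mul, abs_zero]
  rw [Measure.volume_eq_prod, ← Measure.prod_restrict, lintegral_prod _ (by fun_prop)]
  simp only [lintegral_const, Measure.restrict_apply MeasurableSet.univ, univ_inter,
    Real.volume_Ioo]
  rw [lintegral_mul_const _ (by fun_prop), mul_comm]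
  have : ∀ r : ℝ, ENNReal.ofReal (2 * r) = 2 * ENNReal.ofReal r := fun r => by
    rw [ENNReal.ofReal_mul (by norm_num)]; simp
  simp only [this, mul_assoc]
  rw [lintegral_const_mul _ (by fun_prop), ← mul_assoc]
  congr 1
  rw [show Real.pi - -Real.pi = Real.pi * 2 by ring, ENNReal.ofReal_mul Real.pi_nonneg]
  simp

theorem lintegral_complex_comp_smul (f : ℂ → ENNReal) (hf : Measurable f) {a : ℂ} (ha : a ≠ 0)
    (e : ℂ) : ∫⁻ z, f (a * (starRingEnd ℂ) z + e) =
      ENNReal.ofReal (Complex.normSq a)⁻¹ * ∫⁻ u, f u := by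
  -- conjugation preserves Lebesgue measure, and multiplication by `a` has real determinant `|a|²`
  have h1 : ∫⁻ z, f (a * (starRingEnd ℂ) z + e) = ∫⁻ z, f (a * z + e) := by
    have : MeasurePreserving (fun z : ℂ => Complex.conjLIE z) :=
      Complex.conjLIE.measurePreserving
    exact this.lintegral_comp (f := fun z => f (a * z + e)) (by fun_prop)
  have hdet : LinearMap.det (LinearMap.mulLeft ℝ a) = Complex.normSq a := by
    rw [← Algebra.norm_complex_apply, Algebra.norm_apply]
    rfl
  have hne : LinearMap.det (LinearMap.mulLeft ℝ a) ≠ 0 := by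
    rw [hdet]; simpa using ha
  have h2 := Measure.map_linearMap_addHaar_eq_smul_addHaar (volume : Measure ℂ) hne
  rw [h1]
  have h3 : ∫⁻ z, f (a * z + e) = ∫⁻ z, f (z + e) ∂(Measure.map (LinearMap.mulLeft ℝ a) volume) := by
    rw [lintegral_map (by fun_prop) (LinearMap.continuous_of_finiteDimensional _).measurable]
    rfl
  rw [h3, h2, lintegral_smul_measure, lintegral_add_right_eq_self, hdet, smul_eq_mul,
    abs_of_nonneg (inv_nonneg.2 (Complex.normSq_nonneg a))]

/-- Tonelli's theorem on the triangle `a < s < w`. -/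
theorem setLIntegral_Ioi_Ioi_swap {f : ℝ × ℝ → ENNReal} (hf : Measurable f) (a : ℝ) :
    ∫⁻ s in Ioi a, ∫⁻ w in Ioi s, f (s, w) = ∫⁻ w in Ioi a, ∫⁻ s in Ioo a w, f (s, w) := by
  have hT : MeasurableSet {p : ℝ × ℝ | a < p.1 ∧ p.1 < p.2} :=
    (measurableSet_lt measurable_const measurable_fst).inter
      (measurableSet_lt measurable_fst measurable_snd)
  have h1 : ∫⁻ s in Ioi a, ∫⁻ w in Ioi s, f (s, w) =
      ∫⁻ s, ∫⁻ w, {p : ℝ × ℝ | a < p.1 ∧ p.1 < p.2}.indicator f (s, w) := by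
    rw [← lintegral_indicator measurableSet_Ioi]
    refine lintegral_congr fun s => ?_
    by_cases hs : a < s
    · rw [indicator_of_mem (by exact hs), ← lintegral_indicator measurableSet_Ioi]
      refine lintegral_congr fun w => ?_
      simp [indicator_apply, hs]
    · rw [indicator_of_notMem (by exact hs)]
      simp [hs]
  have h2 : ∫⁻ w in Ioi a, ∫⁻ s in Ioo a w, f (s, w) =
      ∫⁻ w, ∫⁻ s, {p : ℝ × ℝ | a < p.1 ∧ p.1 < p.2}.indicator f (s, w) := by
    rw [← lintegral_indicator measurableSet_Ioi]
    refine lintegral_congr fun w => ?_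
    by_cases hw : a < w
    · rw [indicator_of_mem (by exact hw), ← lintegral_indicator measurableSet_Ioo]
      refine lintegral_congr fun s => ?_
      simp [indicator_apply]
    · rw [indicator_of_notMem (by exact hw)]
      refine (lintegral_eq_zero_of_ae_eq_zero (Eventually.of_forall fun s => ?_)).symm
      exact indicator_of_notMem (fun h => hw (h.1.trans h.2)) _
  rw [h1, h2]
  exact lintegral_lintegral_swap (hf.indicator hT).aemeasurable

/-! ### Circularly symmetric complex Gaussians -/

theorem complexGaussian_eq {v : ℝ} (hv : 0 < v) :
    complexGaussian v = volume.withDensity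
      (fun z => ENNReal.ofReal ((Real.pi * v)⁻¹ * Real.exp (-Complex.normSq z / v))) := by
  have hv' : (v / 2).toNNReal ≠ 0 := by
    simpa using hv
  unfold complexGaussian
  rw [gaussianReal_of_var_ne_zero _ hv', prod_withDensity (measurable_gaussianPDF _ _)
    (measurable_gaussianPDF _ _)]
  have hmp := Complex.volume_preserving_equiv_real_prod.symm
  refine Measure.ext_of_lintegral _ fun f hf => ?_
  rw [lintegral_map hf (by exact Complex.measurableEquivRealProd.symm.measurable),
    lintegral_withDensity_eq_lintegral_mul _ (by fun_prop) (by
      exact hf.comp Complex.measurableEquivRealProd.symm.measurable),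
    lintegral_withDensity_eq_lintegral_mul _ (by fun_prop) hf,
    ← hmp.lintegral_comp (by fun_prop)]
  refine lintegral_congr fun p => ?_
  simp only [Pi.mul_apply, gaussianPDF, gaussianPDFReal]
  rw [← ENNReal.ofReal_mul (by positivity)]
  congr 2
  rw [Real.coe_toNNReal _ (by positivity), Complex.measurableEquivRealProd_symm_apply,
    Complex.normSq_mk, mul_mul_mul_comm, ← Real.exp_add, ← mul_inv, Real.mul_self_sqrt (by positivity)]
  congr 2
  · field_simp
  · field_simp
    ring

theorem lintegral_complexGaussian {v : ℝ} (hv : 0 < v) {f : ℂ → ENNReal} (hf : Measurable f) :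
    ∫⁻ z, f z ∂complexGaussian v =
      ∫⁻ z, ENNReal.ofReal ((Real.pi * v)⁻¹ * Real.exp (-Complex.normSq z / v)) * f z := by
  rw [complexGaussian_eq hv, lintegral_withDensity_eq_lintegral_mul _ (by fun_prop) hf]
  rfl

instance isProbabilityMeasure_complexGaussian (v : ℝ) :
    IsProbabilityMeasure (complexGaussian v) := by
  unfold complexGaussian
  exact Measure.isProbabilityMeasure_map
    (Complex.measurableEquivRealProd.symm.measurable).aemeasurable

/-- The squared modulus of a complex Gaussian is exponentially distributed. -/
theorem lintegral_normSq_complexGaussian {v : ℝ} (hv : 0 < v) {G : ℝ → ENNReal}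
    (hG : Measurable G) :
    ∫⁻ z, G (Complex.normSq z) ∂complexGaussian v =
      ∫⁻ s in Ioi 0, ENNReal.ofReal (v⁻¹ * Real.exp (-s / v)) * G s := by
  rw [lintegral_complexGaussian hv (by fun_prop), lintegral_comp_normSq
    (G := fun s => ENNReal.ofReal ((Real.pi * v)⁻¹ * Real.exp (-s / v)) * G s) (by fun_prop),
    ← lintegral_const_mul _ (by fun_prop)]
  refine lintegral_congr fun s => ?_
  have := Real.pi_pos
  rw [← mul_assoc, ← ENNReal.ofReal_mul (by positivity)]
  congr 2
  field_simp

/-! ### The two rows of the matrix -/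

/-- The density of the sum of two independent exponential variables of means `α` and `β`. -/
noncomputable def hypoexpDensity (α β w : ℝ) : ℝ :=
  (Real.exp (-w / β) - Real.exp (-w / α)) / (β - α)

theorem lintegral_exp_convolution {α β : ℝ} (hα : 0 < α) (hβ : 0 < β) (hne : α ≠ β) {w : ℝ}
    (hw : 0 < w) :
    ∫⁻ s in Ioo 0 w, ENNReal.ofReal (α⁻¹ * Real.exp (-s / α)) *
      ENNReal.ofReal (β⁻¹ * Real.exp (-(w - s) / β)) =
      ENNReal.ofReal (hypoexpDensity α β w) := by
  have hd : β - α ≠ 0 := sub_ne_zero.2 hne.symm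
  have hderiv : ∀ s, HasDerivAt
      (fun s => -(Real.exp (-s / α) * Real.exp (-(w - s) / β)) / (β - α))
      (α⁻¹ * Real.exp (-s / α) * (β⁻¹ * Real.exp (-(w - s) / β))) s := by
    intro s
    have h1 : HasDerivAt (fun s : ℝ => Real.exp (-s / α)) (Real.exp (-s / α) * (-1 / α)) s :=
      ((hasDerivAt_id s).neg.div_const α).exp
    have h2 : HasDerivAt (fun s : ℝ => Real.exp (-(w - s) / β))
        (Real.exp (-(w - s) / β) * (-(-1) / β)) s :=
      ((((hasDerivAt_id s).const_sub w).neg).div_const β).exp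
    refine ((h1.mul h2).neg.div_const (β - α)).congr_deriv ?_
    field_simp
    ring
  simp_rw [← fun s : ℝ => ENNReal.ofReal_mul (p := α⁻¹ * Real.exp (-s / α))
    (q := (β⁻¹ * Real.exp (-(w - s) / β))) (by positivity)]
  rw [(setLIntegral_Ioo_ofReal_deriv hw.le (by fun_prop) (fun s _ => hderiv s)
    fun s _ => by positivity).2, hypoexpDensity]
  congr 1
  simp
  ring

theorem lintegral_sum_normSq_complexGaussian {α β : ℝ} (hα : 0 < α) (hβ : 0 < β) (hne : α ≠ β)
    {Φ : ℝ → ENNReal} (hΦ : Measurable Φ) :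
    ∫⁻ a, ∫⁻ b, Φ (Complex.normSq a + Complex.normSq b) ∂complexGaussian β ∂complexGaussian α =
      ∫⁻ w in Ioi 0, ENNReal.ofReal (hypoexpDensity α β w) * Φ w := by
  have h1 : ∀ s : ℝ, ∫⁻ b, Φ (s + Complex.normSq b) ∂complexGaussian β =
      ∫⁻ w in Ioi s, ENNReal.ofReal (β⁻¹ * Real.exp (-(w - s) / β)) * Φ w := by
    intro s
    rw [lintegral_normSq_complexGaussian hβ (G := fun t => Φ (s + t)) (by fun_prop),
      ← lintegral_indicator measurableSet_Ioi, ← lintegral_indicator measurableSet_Ioi,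
      ← lintegral_add_left_eq_self ((Ioi s).indicator _) s]
    refine lintegral_congr fun t => ?_
    simp [indicator_apply]
  simp_rw [h1]
  have hmeas : Measurable fun p : ℝ × ℝ => ENNReal.ofReal (α⁻¹ * Real.exp (-p.1 / α)) *
      (ENNReal.ofReal (β⁻¹ * Real.exp (-(p.2 - p.1) / β)) * Φ p.2) := by fun_prop
  have hΨ : Measurable fun s : ℝ =>
      ∫⁻ w in Ioi s, ENNReal.ofReal (β⁻¹ * Real.exp (-(w - s) / β)) * Φ w := by
    have : ∀ s : ℝ, ∫⁻ w in Ioi s, ENNReal.ofReal (β⁻¹ * Real.exp (-(w - s) / β)) * Φ w =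
      ∫⁻ b, Φ (s + Complex.normSq b) ∂complexGaussian β := fun s => (h1 s).symm
    simp_rw [this]
    fun_prop
  rw [lintegral_normSq_complexGaussian hα (G := fun s =>
      ∫⁻ w in Ioi s, ENNReal.ofReal (β⁻¹ * Real.exp (-(w - s) / β)) * Φ w) hΨ]
  have h2 : ∀ s : ℝ, ENNReal.ofReal (α⁻¹ * Real.exp (-s / α)) *
      ∫⁻ w in Ioi s, ENNReal.ofReal (β⁻¹ * Real.exp (-(w - s) / β)) * Φ w =
      ∫⁻ w in Ioi s, ENNReal.ofReal (α⁻¹ * Real.exp (-s / α)) *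
        (ENNReal.ofReal (β⁻¹ * Real.exp (-(w - s) / β)) * Φ w) := fun s =>
    (lintegral_const_mul _ (by fun_prop)).symm
  simp_rw [h2]
  rw [setLIntegral_Ioi_Ioi_swap hmeas]
  refine setLIntegral_congr_fun measurableSet_Ioi fun w hw => ?_
  simp_rw [← mul_assoc]
  rw [lintegral_mul_const _ (by fun_prop), lintegral_exp_convolution hα hβ hne hw]

/-- For a fixed first row `(a, b)` with `a ≠ 0`, integration over the second row `(c, d)` in the
variables `u = a c̄ + b d̄` and `s = |c|² + |d|² - |u|² / (|a|² + |b|²) > 0`. -/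
theorem lintegral_comp_sumSq_bilin {F : ℝ × ℂ → ENNReal} (hF : Measurable F) {a : ℂ} (ha : a ≠ 0)
    (b : ℂ) :
    ∫⁻ d, ∫⁻ c, F (Complex.normSq c + Complex.normSq d,
        a * (starRingEnd ℂ) c + b * (starRingEnd ℂ) d) =
      ENNReal.ofReal (Real.pi / (Complex.normSq a + Complex.normSq b)) *
        ∫⁻ u, ∫⁻ s in Ioi 0, F (s + Complex.normSq u / (Complex.normSq a + Complex.normSq b), u) := by
  have hA : 0 < Complex.normSq a := Complex.normSq_pos.2 ha
  have hB : 0 ≤ Complex.normSq b := Complex.normSq_nonneg b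
  set A := Complex.normSq a with hAdef
  set w := A + Complex.normSq b with hw
  have hw0 : 0 < w := by positivity
  have h1 : ∀ d : ℂ, ∫⁻ c, F (Complex.normSq c + Complex.normSq d,
        a * (starRingEnd ℂ) c + b * (starRingEnd ℂ) d) =
      ENNReal.ofReal A⁻¹ * ∫⁻ u, F (Complex.normSq (u - b * (starRingEnd ℂ) d) / A +
        Complex.normSq d, u) := by
    intro d
    rw [← lintegral_complex_comp_smul (fun u => F (Complex.normSq (u - b * (starRingEnd ℂ) d) / A +
        Complex.normSq d, u)) (by fun_prop) ha (b * (starRingEnd ℂ) d)]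
    refine lintegral_congr fun c => ?_
    rw [add_sub_cancel_right, map_mul, Complex.normSq_conj, mul_div_cancel_left₀ _ hA.ne']
  simp_rw [h1]
  rw [lintegral_const_mul _ (by fun_prop), lintegral_lintegral_swap (by fun_prop)]
  have h2 : ∀ u : ℂ, ∫⁻ d, F (Complex.normSq (u - b * (starRingEnd ℂ) d) / A +
        Complex.normSq d, u) =
      ENNReal.ofReal (Real.pi * (A / w)) * ∫⁻ s in Ioi 0, F (s + Complex.normSq u / w, u) := by
    intro u
    have e1 : ∀ d : ℂ, Complex.normSq (u - b * (starRingEnd ℂ) d) / A + Complex.normSq d =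
        w / A * Complex.normSq (d - (starRingEnd ℂ) u * b / w) + Complex.normSq u / w := by
      intro d
      have hdiv : (starRingEnd ℂ) u * b / w = ((w⁻¹ : ℝ) : ℂ) * ((starRingEnd ℂ) u * b) := by
        push_cast; field_simp
      rw [hdiv]
      have hB : Complex.normSq b = w - A := by rw [hw]; ring
      rw [Complex.normSq_apply] at hB
      simp only [Complex.normSq_apply, Complex.sub_re, Complex.sub_im, Complex.mul_re,
        Complex.mul_im, Complex.conj_re, Complex.conj_im, Complex.ofReal_re, Complex.ofReal_im]
      -- the identity holds modulo `w = |a|² + |b|²`, used to eliminate `b.im`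
      have hb2 : b.im ^ 2 = w - A - b.re ^ 2 := by linarith
      field_simp
      ring_nf
      simp only [hb2]
      ring
    simp_rw [e1]
    rw [lintegral_sub_right_eq_self
      (fun d => F (w / A * Complex.normSq d + Complex.normSq u / w, u)),
      lintegral_comp_normSq (G := fun s => F (w / A * s + Complex.normSq u / w, u)) (by fun_prop)]
    have hc : 0 < w / A := by positivity
    have h3 := lintegral_comp_mul_add (fun y => (Ioi 0).indicator
      (fun s => F (s + Complex.normSq u / w, u)) y) hc.ne' 0
    rw [lintegral_indicator measurableSet_Ioi, abs_of_pos (by positivity), inv_div] at h3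
    rw [ENNReal.ofReal_mul Real.pi_nonneg, mul_assoc, ← h3, ← lintegral_indicator measurableSet_Ioi]
    congr 1
    refine lintegral_congr fun s => ?_
    simp [indicator_apply, hc]
  simp_rw [h2]
  rw [lintegral_const_mul _ (by
    exact Measurable.lintegral_prod_right' (f := fun p : ℂ × ℝ =>
      F (p.2 + Complex.normSq p.1 / w, p.1)) (by fun_prop)), ← mul_assoc,
    ← ENNReal.ofReal_mul (by positivity)]
  congr 2
  field_simp

/-- The joint law of `|c|² + |d|²` and `a c̄ + b d̄` for independent `c, d ∼ 𝒞𝒩(0, v)`: it depends on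
`(a, b)` only through `|a|² + |b|²`. -/
theorem lintegral_second_row {v : ℝ} (hv : 0 < v) {F : ℝ × ℂ → ENNReal} (hF : Measurable F)
    {a : ℂ} (ha : a ≠ 0) (b : ℂ) :
    ∫⁻ d, ∫⁻ c, F (Complex.normSq c + Complex.normSq d,
        a * (starRingEnd ℂ) c + b * (starRingEnd ℂ) d) ∂complexGaussian v ∂complexGaussian v =
      ENNReal.ofReal ((Real.pi * v ^ 2)⁻¹ / (Complex.normSq a + Complex.normSq b)) *
      ∫⁻ u, ∫⁻ s in Ioi 0, ENNReal.ofReal (Real.exp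
        (-(s + Complex.normSq u / (Complex.normSq a + Complex.normSq b)) / v)) *
          F (s + Complex.normSq u / (Complex.normSq a + Complex.normSq b), u) := by
  have hw0 : 0 < Complex.normSq a + Complex.normSq b := by
    have := Complex.normSq_pos.2 ha
    have := Complex.normSq_nonneg b
    positivity
  have hπ := Real.pi_pos
  have h1 : ∀ d : ℂ, ∫⁻ c, F (Complex.normSq c + Complex.normSq d,
        a * (starRingEnd ℂ) c + b * (starRingEnd ℂ) d) ∂complexGaussian v =
      ∫⁻ c, ENNReal.ofReal ((Real.pi * v)⁻¹ * Real.exp (-Complex.normSq c / v)) *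
        F (Complex.normSq c + Complex.normSq d,
        a * (starRingEnd ℂ) c + b * (starRingEnd ℂ) d) := fun d =>
    lintegral_complexGaussian hv (by fun_prop)
  simp_rw [h1]
  rw [lintegral_complexGaussian hv (by fun_prop)]
  have h2 : ∀ d : ℂ, ENNReal.ofReal ((Real.pi * v)⁻¹ * Real.exp (-Complex.normSq d / v)) *
      ∫⁻ c, ENNReal.ofReal ((Real.pi * v)⁻¹ * Real.exp (-Complex.normSq c / v)) *
        F (Complex.normSq c + Complex.normSq d,
        a * (starRingEnd ℂ) c + b * (starRingEnd ℂ) d) =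
      ∫⁻ c, (fun p : ℝ × ℂ => ENNReal.ofReal (((Real.pi * v)⁻¹) ^ 2) *
        (ENNReal.ofReal (Real.exp (-p.1 / v)) * F p))
        (Complex.normSq c + Complex.normSq d,
        a * (starRingEnd ℂ) c + b * (starRingEnd ℂ) d) := by
    intro d
    rw [← lintegral_const_mul _ (by fun_prop)]
    refine lintegral_congr fun c => ?_
    simp only
    rw [← mul_assoc, ← mul_assoc, ← ENNReal.ofReal_mul (by positivity),
      ← ENNReal.ofReal_mul (by positivity), mul_mul_mul_comm, ← Real.exp_add, ← sq]
    congr 4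
    ring
  simp_rw [h2]
  rw [lintegral_comp_sumSq_bilin (F := (fun p : ℝ × ℂ => ENNReal.ofReal (((Real.pi * v)⁻¹) ^ 2) *
        (ENNReal.ofReal (Real.exp (-p.1 / v)) * F p))) (by fun_prop) ha b]
  simp only
  have h3 : ∀ u : ℂ, ∫⁻ s in Ioi 0, ENNReal.ofReal (((Real.pi * v)⁻¹) ^ 2) *
      (ENNReal.ofReal (Real.exp
        (-(s + Complex.normSq u / (Complex.normSq a + Complex.normSq b)) / v)) *
          F (s + Complex.normSq u / (Complex.normSq a + Complex.normSq b), u)) =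
      ENNReal.ofReal (((Real.pi * v)⁻¹) ^ 2) * ∫⁻ s in Ioi 0,
      (ENNReal.ofReal (Real.exp
        (-(s + Complex.normSq u / (Complex.normSq a + Complex.normSq b)) / v)) *
          F (s + Complex.normSq u / (Complex.normSq a + Complex.normSq b), u)) := fun u =>
    lintegral_const_mul _ (by fun_prop)
  simp_rw [h3]
  rw [lintegral_const_mul _ (by
    exact Measurable.lintegral_prod_right' (f := fun p : ℂ × ℝ =>
      ENNReal.ofReal (Real.exp
        (-(p.2 + Complex.normSq p.1 / (Complex.normSq a + Complex.normSq b)) / v)) *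
      F (p.2 + Complex.normSq p.1 / (Complex.normSq a + Complex.normSq b), p.1)) (by fun_prop)),
    ← mul_assoc, ← ENNReal.ofReal_mul (by positivity)]
  congr 2
  field_simp

/-! ### The density of the Gram matrix -/

/-- Integration against the joint law of the entries. The order of the last row matches
`lintegral_second_row`. -/
theorem lintegral_matrix_entries {Ω : Type*} [MeasurableSpace Ω] {P : Measure Ω}
    [IsProbabilityMeasure P] {H : Ω → Matrix (Fin 2) (Fin 2) ℂ} {φ : Fin 2 → Fin 2 → ℝ}
    (hlaw : ∀ i j, HasLaw (fun ω => H ω i j) (complexGaussian (φ i j)) P)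
    (hindep : iIndepFun (fun (p : Fin 2 × Fin 2) (ω : Ω) => H ω p.1 p.2) P)
    {G : (ℂ × ℂ) × (ℂ × ℂ) → ENNReal} (hG : Measurable G) :
    ∫⁻ ω, G ((H ω 0 0, H ω 0 1), (H ω 1 1, H ω 1 0)) ∂P =
      ∫⁻ a, ∫⁻ b, ∫⁻ d, ∫⁻ c, G ((a, b), (d, c)) ∂complexGaussian (φ 1 0)
        ∂complexGaussian (φ 1 1) ∂complexGaussian (φ 0 1) ∂complexGaussian (φ 0 0) := by
  have hm : ∀ i j, AEMeasurable (fun ω => H ω i j) P := fun i j => (hlaw i j).aemeasurable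
  have hp : ∀ p q : Fin 2 × Fin 2, p ≠ q →
      P.map (fun ω => (H ω p.1 p.2, H ω q.1 q.2)) =
        (complexGaussian (φ p.1 p.2)).prod (complexGaussian (φ q.1 q.2)) := by
    intro p q hpq
    have h := (hindep.indepFun hpq).map_prod_eq_prod_map_map (hm _ _) (hm _ _)
    rwa [(hlaw _ _).map_eq, (hlaw _ _).map_eq] at h
  have hrows := (hindep.indepFun_prodMk_prodMk₀ (fun p => hm p.1 p.2) (0, 0) (0, 1) (1, 1) (1, 0)
    (by decide) (by decide) (by decide) (by decide)).map_prod_eq_prod_map_map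
      ((hm _ _).prodMk (hm _ _)) ((hm _ _).prodMk (hm _ _))
  rw [hp (0, 0) (0, 1) (by decide), hp (1, 1) (1, 0) (by decide)] at hrows
  simp only at hrows
  have hmap : AEMeasurable (fun ω => ((H ω 0 0, H ω 0 1), (H ω 1 1, H ω 1 0))) P :=
    ((hm _ _).prodMk (hm _ _)).prodMk ((hm _ _).prodMk (hm _ _))
  rw [← lintegral_map' (f := G) hG.aemeasurable hmap, hrows, lintegral_prod _ hG.aemeasurable,
    lintegral_prod _ (by fun_prop)]
  refine lintegral_congr fun a => lintegral_congr fun b => ?_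
  exact lintegral_prod _ (by fun_prop)

/-- The entries `(w₁, w₂, w₃)` of the Gram matrix `H Hᴴ = (w₁, w₃; w₃*, w₂)`. -/
noncomputable def gramEntries (H : Matrix (Fin 2) (Fin 2) ℂ) : ℝ × ℝ × ℂ :=
  (Complex.normSq (H 0 0) + Complex.normSq (H 0 1),
    Complex.normSq (H 1 0) + Complex.normSq (H 1 1),
    H 0 0 * (starRingEnd ℂ) (H 1 0) + H 0 1 * (starRingEnd ℂ) (H 1 1))

/-- The density of the entries `(w₁, w₂, w₃)` when the first row of `H` has variances `α`, `β` and
the second row has the common variance `v`. It is supported on the positive definite matrices,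
which differ from the positive semidefinite ones by a null set. -/
noncomputable def gramEntriesDensity (α β v : ℝ) : ℝ × ℝ × ℂ → ℝ :=
  {p : ℝ × ℝ × ℂ | 0 < p.1 ∧ Complex.normSq p.2.2 < p.1 * p.2.1}.indicator fun p =>
    hypoexpDensity α β p.1 * ((Real.pi * v ^ 2)⁻¹ / p.1) * Real.exp (-p.2.1 / v)

theorem hypoexpDensity_nonneg {α β w : ℝ} (hα : 0 < α) (hβ : 0 < β) (hw : 0 ≤ w) :
    0 ≤ hypoexpDensity α β w := by
  unfold hypoexpDensity
  rcases le_total α β with h | h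
  · refine div_nonneg (sub_nonneg.2 (Real.exp_le_exp.2 ?_)) (sub_nonneg.2 h)
    rw [neg_div, neg_div, neg_le_neg_iff]
    exact div_le_div_of_nonneg_left hw hα h
  · refine div_nonneg_of_nonpos (sub_nonpos.2 (Real.exp_le_exp.2 ?_)) (sub_nonpos.2 h)
    rw [neg_div, neg_div, neg_le_neg_iff]
    exact div_le_div_of_nonneg_left hw hβ h

@[fun_prop]
theorem measurable_hypoexpDensity (α β : ℝ) : Measurable (hypoexpDensity α β) := by
  unfold hypoexpDensity
  fun_prop

@[fun_prop]
theorem measurable_gramEntriesDensity (α β v : ℝ) : Measurable (gramEntriesDensity α β v) := by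
  have h1 : MeasurableSet {p : ℝ × ℝ × ℂ | 0 < p.1} :=
    measurableSet_lt measurable_const measurable_fst
  have h2 : MeasurableSet {p : ℝ × ℝ × ℂ | Complex.normSq p.2.2 < p.1 * p.2.1} :=
    measurableSet_lt (by fun_prop) (by fun_prop)
  exact Measurable.indicator (by fun_prop) (h1.inter h2)

theorem lintegral_gramEntries_iterated {Ω : Type*} [MeasurableSpace Ω] {P : Measure Ω}
    [IsProbabilityMeasure P] {H : Ω → Matrix (Fin 2) (Fin 2) ℂ} {φ : Fin 2 → Fin 2 → ℝ} {v : ℝ}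
    (hpos : ∀ i j, 0 < φ i j)
    (hlaw : ∀ i j, HasLaw (fun ω => H ω i j) (complexGaussian (φ i j)) P)
    (hindep : iIndepFun (fun (p : Fin 2 × Fin 2) (ω : Ω) => H ω p.1 p.2) P)
    (h21 : φ 1 0 = v) (h22 : φ 1 1 = v) (hne : φ 0 0 ≠ φ 0 1)
    {F : ℝ × ℝ × ℂ → ENNReal} (hF : Measurable F) :
    ∫⁻ ω, F (gramEntries (H ω)) ∂P =
      ∫⁻ w in Ioi 0, ENNReal.ofReal (hypoexpDensity (φ 0 0) (φ 0 1) w) *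
        (ENNReal.ofReal ((Real.pi * v ^ 2)⁻¹ / w) *
          ∫⁻ u : ℂ, ∫⁻ s in Ioi 0, ENNReal.ofReal (Real.exp (-(s + Complex.normSq u / w) / v)) *
            F (w, s + Complex.normSq u / w, u)) := by
  have hv : 0 < v := h21 ▸ hpos 1 0
  have hG : Measurable fun p : (ℂ × ℂ) × (ℂ × ℂ) =>
      F (Complex.normSq p.1.1 + Complex.normSq p.1.2,
        Complex.normSq p.2.2 + Complex.normSq p.2.1,
        p.1.1 * (starRingEnd ℂ) p.2.2 + p.1.2 * (starRingEnd ℂ) p.2.1) := by fun_prop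
  have hΦ : Measurable fun w : ℝ => ENNReal.ofReal ((Real.pi * v ^ 2)⁻¹ / w) *
      ∫⁻ u : ℂ, ∫⁻ s in Ioi 0, ENNReal.ofReal (Real.exp (-(s + Complex.normSq u / w) / v)) *
        F (w, s + Complex.normSq u / w, u) := by
    refine Measurable.mul (by fun_prop) ?_
    refine Measurable.lintegral_prod_right' (f := fun p : ℝ × ℂ => ∫⁻ s in Ioi 0,
      ENNReal.ofReal (Real.exp (-(s + Complex.normSq p.2 / p.1) / v)) *
        F (p.1, s + Complex.normSq p.2 / p.1, p.2)) ?_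
    exact Measurable.lintegral_prod_right' (f := fun q : (ℝ × ℂ) × ℝ =>
      ENNReal.ofReal (Real.exp (-(q.2 + Complex.normSq q.1.2 / q.1.1) / v)) *
        F (q.1.1, q.2 + Complex.normSq q.1.2 / q.1.1, q.1.2)) (by fun_prop)
  rw [← lintegral_sum_normSq_complexGaussian (hpos 0 0) (hpos 0 1) hne hΦ]
  have h := lintegral_matrix_entries hlaw hindep hG
  simp only at h
  refine (h.trans ?_)
  -- the change of variables in the second row needs `a ≠ 0`
  have hae : ∀ᵐ a ∂complexGaussian (φ 0 0), a ≠ 0 := by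
    rw [complexGaussian_eq (hpos 0 0)]
    exact (withDensity_absolutelyContinuous _ _).ae_le (Measure.ae_ne volume 0)
  refine lintegral_congr_ae (hae.mono fun a ha => lintegral_congr fun b => ?_)
  rw [h21, h22]
  exact lintegral_second_row hv (F := fun q : ℝ × ℂ => F
    (Complex.normSq a + Complex.normSq b, q.1, q.2)) (by fun_prop) ha b

theorem lintegral_gramEntries {Ω : Type*} [MeasurableSpace Ω] {P : Measure Ω}
    [IsProbabilityMeasure P] {H : Ω → Matrix (Fin 2) (Fin 2) ℂ} {φ : Fin 2 → Fin 2 → ℝ} {v : ℝ}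
    (hpos : ∀ i j, 0 < φ i j)
    (hlaw : ∀ i j, HasLaw (fun ω => H ω i j) (complexGaussian (φ i j)) P)
    (hindep : iIndepFun (fun (p : Fin 2 × Fin 2) (ω : Ω) => H ω p.1 p.2) P)
    (h21 : φ 1 0 = v) (h22 : φ 1 1 = v) (hne : φ 0 0 ≠ φ 0 1)
    {F : ℝ × ℝ × ℂ → ENNReal} (hF : Measurable F) :
    ∫⁻ ω, F (gramEntries (H ω)) ∂P =
      ∫⁻ p, ENNReal.ofReal (gramEntriesDensity (φ 0 0) (φ 0 1) v p) * F p := by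
  rw [lintegral_gramEntries_iterated hpos hlaw hindep h21 h22 hne hF,
    Measure.volume_eq_prod, lintegral_prod _ (by fun_prop), ← lintegral_indicator measurableSet_Ioi]
  refine lintegral_congr fun w => ?_
  by_cases hw : 0 < w
  · rw [indicator_of_mem (by exact hw), Measure.volume_eq_prod, lintegral_prod_symm _ (by fun_prop),
      ← mul_assoc, ← ENNReal.ofReal_mul (hypoexpDensity_nonneg (hpos 0 0) (hpos 0 1) hw.le),
      ← lintegral_const_mul' _ _ ENNReal.ofReal_ne_top]
    refine lintegral_congr fun u => ?_
    rw [← lintegral_const_mul' _ _ ENNReal.ofReal_ne_top,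
      ← lintegral_indicator measurableSet_Ioi,
      ← lintegral_add_right_eq_self (fun y => ENNReal.ofReal
        (gramEntriesDensity (φ 0 0) (φ 0 1) v (w, y, u)) * F (w, y, u)) (Complex.normSq u / w)]
    refine lintegral_congr fun s => ?_
    have hiff : Complex.normSq u < w * (s + Complex.normSq u / w) ↔ 0 < s := by
      rw [mul_add, mul_div_cancel₀ _ hw.ne', lt_add_iff_pos_left, mul_pos_iff_of_pos_left hw]
    by_cases hs : 0 < s
    · rw [indicator_of_mem (by exact hs), gramEntriesDensity,
        indicator_of_mem (by exact ⟨hw, hiff.2 hs⟩), ← mul_assoc, ← ENNReal.ofReal_mul' (by positivity)]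
    · rw [indicator_of_notMem (by exact hs), gramEntriesDensity,
        indicator_of_notMem (by exact fun h => hs (hiff.1 h.2))]
      simp
  · rw [indicator_of_notMem (by exact hw)]
    refine (lintegral_eq_zero_of_ae_eq_zero (Eventually.of_forall fun q => ?_)).symm
    simp only [Pi.zero_apply]
    rw [gramEntriesDensity, indicator_of_notMem (by exact fun h => hw h.1)]
    simp

theorem gram_eq_hermitianOfEntries (H : Matrix (Fin 2) (Fin 2) ℂ) :
    gram H = hermitianOfEntries (gramEntries H) := by
  ext i j
  fin_cases i <;> fin_cases j <;>
    simp [gram, hermitianOfEntries, gramEntries, Matrix.mul_apply, Fin.sum_univ_two,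
      Matrix.conjTranspose_apply, Complex.normSq_eq_conj_mul_self, mul_comm]

theorem measurable_hermitianOfEntries : Measurable hermitianOfEntries := by
  refine measurable_pi_lambda _ fun i => measurable_pi_lambda _ fun j => ?_
  fin_cases i <;> fin_cases j <;> simp [hermitianOfEntries] <;> fun_prop

theorem aemeasurable_gramEntries {Ω : Type*} [MeasurableSpace Ω] {P : Measure Ω}
    {H : Ω → Matrix (Fin 2) (Fin 2) ℂ} (hm : ∀ i j, AEMeasurable (fun ω => H ω i j) P) :
    AEMeasurable (fun ω => gramEntries (H ω)) P := by
  have h00 := hm 0 0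
  have h01 := hm 0 1
  have h10 := hm 1 0
  have h11 := hm 1 1
  unfold gramEntries
  fun_prop

theorem posSemidef_iff_entries (W : Matrix (Fin 2) (Fin 2) ℂ) :
    W.PosSemidef ↔ (W 0 0).im = 0 ∧ (W 1 1).im = 0 ∧ W 1 0 = star (W 0 1) ∧
      0 ≤ (W 0 0).re ∧ 0 ≤ (W 1 1).re ∧ Complex.normSq (W 0 1) ≤ (W 0 0).re * (W 1 1).re := by
  constructor
  · intro h
    have hd0 := h.diag_nonneg (i := 0)
    have hd1 := h.diag_nonneg (i := 1)
    have h10 : W 1 0 = star (W 0 1) := (h.isHermitian.apply 1 0).symm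
    have hdet := h.det_nonneg
    rw [Complex.le_def] at hd0 hd1 hdet
    have hd0i : (W 0 0).im = 0 := by simpa using hd0.2.symm
    have hd1i : (W 1 1).im = 0 := by simpa using hd1.2.symm
    refine ⟨hd0i, hd1i, h10, by simpa using hd0.1, by simpa using hd1.1, ?_⟩
    have := hdet.1
    rw [Matrix.det_fin_two, h10] at this
    simp [hd0i, hd1i] at this
    rw [Complex.normSq_apply]
    linarith
  · rintro ⟨h0, h1, h10, hp0, hp1, hdet⟩
    refine Matrix.PosSemidef.of_dotProduct_mulVec_nonneg ?_ fun x => ?_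
    · ext i j
      fin_cases i <;> fin_cases j <;>
        simp [Matrix.conjTranspose_apply, h10, Complex.ext_iff, h0, h1]
    · rw [Complex.normSq_apply] at hdet
      simp only [dotProduct, Matrix.mulVec, Fin.sum_univ_two, h10, Pi.star_apply]
      rw [Complex.le_def]
      simp only [Complex.star_def, Complex.add_re, Complex.add_im, Complex.mul_re, Complex.mul_im,
        Complex.conj_re, Complex.conj_im, h0, h1, Complex.zero_re, Complex.zero_im]
      constructor
      · have key : 0 ≤ (W 0 0).re * (x 0).normSq + (W 1 1).re * (x 1).normSq +
            2 * ((star (x 0) * W 0 1 * x 1).re) := by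
          rw [← Complex.normSq_apply, Complex.normSq_eq_norm_sq] at hdet
          have hm : ‖W 0 1‖ ≤ √(W 0 0).re * √(W 1 1).re := by
            rw [← Real.sqrt_mul hp0]
            exact Real.le_sqrt_of_sq_le hdet
          have hre := (abs_le.1 (Complex.abs_re_le_norm (star (x 0) * W 0 1 * x 1))).1
          rw [norm_mul, norm_mul, norm_star] at hre
          have hxy := mul_le_mul_of_nonneg_right hm (mul_nonneg (norm_nonneg (x 0))
            (norm_nonneg (x 1)))
          have hsq := sq_nonneg (√(W 0 0).re * ‖x 0‖ - √(W 1 1).re * ‖x 1‖)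
          rw [sub_sq, mul_pow, mul_pow, Real.sq_sqrt hp0, Real.sq_sqrt hp1] at hsq
          rw [Complex.normSq_eq_norm_sq, Complex.normSq_eq_norm_sq]
          linarith
        simp only [Complex.normSq_apply, Complex.star_def, Complex.mul_re, Complex.mul_im,
          Complex.conj_re, Complex.conj_im] at key
        linarith
      · ring

theorem measurableSet_posSemidef : MeasurableSet {W : Matrix (Fin 2) (Fin 2) ℂ | W.PosSemidef} := by
  have he : ∀ i j, Measurable fun W : Matrix (Fin 2) (Fin 2) ℂ => W i j := fun i j =>
    (measurable_pi_apply j).comp (measurable_pi_apply (X := fun _ : Fin 2 => Fin 2 → ℂ) i)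
  have h00 := he 0 0
  have h01 := he 0 1
  have h10 := he 1 0
  have h11 := he 1 1
  simp only [posSemidef_iff_entries, ofPred_and]
  refine ((measurableSet_eq_fun ?_ ?_).inter ((measurableSet_eq_fun ?_ ?_).inter
    ((measurableSet_eq_fun ?_ ?_).inter ((measurableSet_le ?_ ?_).inter
    ((measurableSet_le ?_ ?_).inter (measurableSet_le ?_ ?_))))))
  all_goals fun_prop

theorem measurable_gramDensity (φ : Fin 2 → Fin 2 → ℝ) : Measurable (gramDensity φ) := by
  have he : ∀ i j, Measurable fun W : Matrix (Fin 2) (Fin 2) ℂ => W i j := fun i j =>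
    (measurable_pi_apply j).comp (measurable_pi_apply (X := fun _ : Fin 2 => Fin 2 → ℂ) i)
  have h00 := he 0 0
  have h11 := he 1 1
  refine Measurable.indicator ?_ measurableSet_posSemidef
  fun_prop

theorem gramDensity_nonneg {φ : Fin 2 → Fin 2 → ℝ} (hpos : ∀ i j, 0 < φ i j)
    (W : Matrix (Fin 2) (Fin 2) ℂ) : 0 ≤ gramDensity φ W := by
  refine indicator_nonneg (fun W hW => ?_) W
  have h := ((posSemidef_iff_entries W).1 hW).2.2.2.1
  have hK : 0 ≤ profileK φ := Finset.prod_nonneg fun i _ => Finset.prod_nonneg fun j _ =>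
    (one_div_pos.2 (hpos i j)).le
  have hx : 0 ≤ 1 / 2 * (W 0 0).re * |profileEps φ 0| := by positivity
  have := Real.sinh_nonneg_iff.2 hx
  have := Real.pi_pos
  positivity

/-- The density in the theorem agrees with `gramEntriesDensity` except where `w₁ = 0` or the
determinant vanishes, which is a null set. -/
theorem gramDensity_eq_gramEntriesDensity {φ : Fin 2 → Fin 2 → ℝ} {v : ℝ}
    (hpos : ∀ i j, 0 < φ i j) (h21 : φ 1 0 = v) (h22 : φ 1 1 = v) (hne : φ 0 0 ≠ φ 0 1)
    {w₁ w₂ : ℝ} {u : ℂ} (h1 : w₁ ≠ 0) (h2 : w₂ ≠ Complex.normSq u / w₁) :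
    gramDensity φ (hermitianOfEntries (w₁, w₂, u)) =
      gramEntriesDensity (φ 0 0) (φ 0 1) v (w₁, w₂, u) := by
  have hiff : (hermitianOfEntries (w₁, w₂, u)).PosSemidef ↔
      0 < w₁ ∧ Complex.normSq u < w₁ * w₂ := by
    rw [posSemidef_iff_entries]
    simp only [hermitianOfEntries, Matrix.of_apply, Matrix.cons_val', Matrix.cons_val_zero,
      Matrix.cons_val_one, Complex.ofReal_im, Complex.ofReal_re, true_and, Matrix.cons_val_fin_one]
    constructor
    · rintro ⟨hw1, hw2, h⟩
      have hw : 0 < w₁ := lt_of_le_of_ne hw1 h1.symm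
      refine ⟨hw, lt_of_le_of_ne h fun he => h2 ?_⟩
      rw [he, mul_div_cancel_left₀ _ h1]
    · rintro ⟨hw, h⟩
      refine ⟨hw.le, ?_, h.le⟩
      exact (pos_of_mul_pos_right ((Complex.normSq_nonneg u).trans_lt h) hw.le).le
  by_cases hp : 0 < w₁ ∧ Complex.normSq u < w₁ * w₂
  · rw [gramDensity, gramEntriesDensity, indicator_of_mem (by exact hiff.2 hp),
      indicator_of_mem (by exact hp)]
    have hw := hp.1
    have hα := hpos 0 0
    have hβ := hpos 0 1
    have hv : 0 < v := h21 ▸ hpos 1 0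
    -- `sinh x / x` is even, which removes the absolute value (also at `x = 0`, with `0 / 0 = 0`)
    have hsinh : ∀ x y : ℝ, Real.sinh (x * |y|) / (x * |y|) = Real.sinh (x * y) / (x * y) := by
      intro x y
      rcases abs_choice y with h | h <;> rw [h]
      rw [mul_neg, Real.sinh_neg, neg_div_neg_eq]
    rw [hsinh]
    simp only [hermitianOfEntries, Matrix.of_apply, Matrix.cons_val', Matrix.cons_val_zero,
      Matrix.cons_val_one, Complex.ofReal_re, Matrix.cons_val_fin_one, profileK,
      Fin.prod_univ_two, profileS, profileEps, h21, h22, hypoexpDensity]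
    set α := φ 0 0
    set β := φ 0 1
    rw [Real.sinh_eq]
    have e1 : Real.exp (-(w₁ / β)) * Real.exp (-(w₂ / v)) =
        Real.exp (-(1 / 2) * (w₁ * (1 / α + 1 / β) + w₂ * (1 / v + 1 / v))) *
          Real.exp (1 / 2 * w₁ * (1 / α - 1 / β)) := by
      rw [← Real.exp_add, ← Real.exp_add]
      congr 1
      ring
    have e2 : Real.exp (-(w₁ / α)) * Real.exp (-(w₂ / v)) =
        Real.exp (-(1 / 2) * (w₁ * (1 / α + 1 / β) + w₂ * (1 / v + 1 / v))) *
          Real.exp (-(1 / 2 * w₁ * (1 / α - 1 / β))) := by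
      rw [← Real.exp_add, ← Real.exp_add]
      congr 1
      ring
    have hd : β - α ≠ 0 := sub_ne_zero.2 hne.symm
    have hc : 1 / 2 * w₁ * (1 / α - 1 / β) = w₁ * (β - α) / (2 * α * β) := by
      field_simp
    have hr : (Real.exp (-w₁ / β) - Real.exp (-w₁ / α)) / (β - α) * ((Real.pi * v ^ 2)⁻¹ / w₁) *
        Real.exp (-w₂ / v) = (Real.exp (-(w₁ / β)) * Real.exp (-(w₂ / v)) -
          Real.exp (-(w₁ / α)) * Real.exp (-(w₂ / v))) / (β - α) * ((Real.pi * v ^ 2)⁻¹ / w₁) := by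
      rw [neg_div, neg_div, neg_div]
      ring
    rw [hr, e1, e2]
    generalize Real.exp (-(1 / 2) * (w₁ * (1 / α + 1 / β) + w₂ * (1 / v + 1 / v))) = X
    generalize Real.exp (-(1 / 2 * w₁ * (1 / α - 1 / β))) = Y
    generalize Real.exp (1 / 2 * w₁ * (1 / α - 1 / β)) = Z
    rw [hc]
    have hπ := Real.pi_ne_zero
    field_simp
  · rw [gramDensity, gramEntriesDensity, indicator_of_notMem (by exact fun h => hp (hiff.1 h)),
      indicator_of_notMem (by exact hp)]

theorem hasDensity_gram {Ω : Type*} [MeasurableSpace Ω] {P : Measure Ω}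
    [IsProbabilityMeasure P] {H : Ω → Matrix (Fin 2) (Fin 2) ℂ} {φ : Fin 2 → Fin 2 → ℝ} {v : ℝ}
    (hpos : ∀ i j, 0 < φ i j)
    (hlaw : ∀ i j, HasLaw (fun ω => H ω i j) (complexGaussian (φ i j)) P)
    (hindep : iIndepFun (fun (p : Fin 2 × Fin 2) (ω : Ω) => H ω p.1 p.2) P)
    (h21 : φ 1 0 = v) (h22 : φ 1 1 = v) (hne : φ 0 0 ≠ φ 0 1) :
    HasDensity (fun ω => gram (H ω)) P hermitianVolume (gramDensity φ) := by
  have hm : AEMeasurable (fun ω => gram (H ω)) P := by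
    simp_rw [gram_eq_hermitianOfEntries]
    exact measurable_hermitianOfEntries.comp_aemeasurable
      (aemeasurable_gramEntries fun i j => (hlaw i j).aemeasurable)
  have hd := measurable_gramDensity φ
  refine ⟨hm, gramDensity_nonneg hpos, hd.aemeasurable, Measure.ext_of_lintegral _ fun f hf => ?_⟩
  have hh := measurable_hermitianOfEntries
  rw [lintegral_map' hf.aemeasurable hm, lintegral_withDensity_eq_lintegral_mul _ (by fun_prop) hf,
    hermitianVolume, lintegral_map (by fun_prop) hh]
  simp_rw [gram_eq_hermitianOfEntries]
  rw [lintegral_gramEntries hpos hlaw hindep h21 h22 hne (F := fun p => f (hermitianOfEntries p))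
    (by fun_prop)]
  have hae : ∀ᵐ p : ℝ × ℝ × ℂ, p.1 ≠ 0 ∧ p.2.1 ≠ Complex.normSq p.2.2 / p.1 := by
    refine (Measure.quasiMeasurePreserving_fst.ae (Measure.ae_ne volume 0)).and ?_
    have hms : MeasurableSet {p : ℝ × ℝ × ℂ | p.2.1 ≠ Complex.normSq p.2.2 / p.1} :=
      (measurableSet_eq_fun (by fun_prop) (by fun_prop)).compl
    refine (Measure.ae_prod_iff_ae_ae hms).2 (Eventually.of_forall fun w => ?_)
    have hms' : MeasurableSet {q : ℝ × ℂ | q.1 = Complex.normSq q.2 / w} :=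
      measurableSet_eq_fun (by fun_prop) (by fun_prop)
    have h0 : (volume : Measure (ℝ × ℂ)) {q : ℝ × ℂ | q.1 = Complex.normSq q.2 / w} = 0 := by
      rw [Measure.volume_eq_prod, Measure.prod_apply_symm hms']
      simp [preimage]
    rw [ae_iff]
    simpa using h0
  refine lintegral_congr_ae (hae.mono fun p hp => ?_)
  simp only [Pi.mul_apply]
  rw [gramDensity_eq_gramEntriesDensity hpos h21 h22 hne hp.1 hp.2]

/-! ### From the entries to the eigenvalues -/

/-- The change of variables from the second diagonal entry `v` and the squared modulus `σ` of the
off-diagonal entry to the eigenvalues `x > y`, for a fixed first diagonal entry `w`. The condition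
`σ > 0` becomes `y < w < x`, and the Jacobian is `x - y`. -/
theorem lintegral_comp_eigenvalues {G : ℝ × ℝ → ENNReal} (hG : Measurable G) (w : ℝ) :
    ∫⁻ v, ∫⁻ σ in Ioi 0, G ((w + v) / 2 + √(((w - v) / 2) ^ 2 + σ),
        (w + v) / 2 - √(((w - v) / 2) ^ 2 + σ)) =
      ∫⁻ x in Ioi w, ∫⁻ y in Iio w, ENNReal.ofReal (x - y) * G (x, y) := by
  have hset : MeasurableSet {p : ℝ × ℝ | w < p.1 ∧ p.2 < w} :=
    (measurableSet_lt measurable_const measurable_fst).inter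
      (measurableSet_lt measurable_snd measurable_const)
  have hset' : MeasurableSet {p : ℝ × ℝ | |(w - p.1) / 2| < p.2} :=
    measurableSet_lt (by fun_prop) (by fun_prop)
  have hK : Measurable ({p : ℝ × ℝ | w < p.1 ∧ p.2 < w}.indicator fun p =>
      ENNReal.ofReal (p.1 - p.2) * G p) := Measurable.indicator (by fun_prop) hset
  set K : ℝ × ℝ → ENNReal := {p : ℝ × ℝ | w < p.1 ∧ p.2 < w}.indicator fun p =>
      ENNReal.ofReal (p.1 - p.2) * G p with hKdef
  have h1 : ∀ v : ℝ, ∫⁻ σ in Ioi 0, G ((w + v) / 2 + √(((w - v) / 2) ^ 2 + σ),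
        (w + v) / 2 - √(((w - v) / 2) ^ 2 + σ)) =
      ∫⁻ r, K ((w + v) / 2 + r, (w + v) / 2 - r) := by
    intro v
    rw [setLIntegral_Ioi_comp_sqrt (fun r => G ((w + v) / 2 + r, (w + v) / 2 - r)),
      ← lintegral_indicator measurableSet_Ioi]
    refine lintegral_congr fun r => ?_
    have hiff : |(w - v) / 2| < r ↔ w < (w + v) / 2 + r ∧ (w + v) / 2 - r < w := by
      rw [abs_lt]
      constructor
      · rintro ⟨h, h'⟩
        constructor <;> linarith
      · rintro ⟨h, h'⟩
        constructor <;> linarith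
    by_cases hr : |(w - v) / 2| < r
    · rw [indicator_of_mem (by exact hr), hKdef, indicator_of_mem (by exact hiff.1 hr)]
      simp only
      congr 2
      ring
    · rw [indicator_of_notMem (by exact hr), hKdef,
        indicator_of_notMem (by exact fun h => hr (hiff.2 h))]
  -- first `v` is replaced by `x = (w + v) / 2 + r`, then `r` by `y = x - 2 * r`
  have h2 : ∀ r : ℝ, ∫⁻ v, K ((w + v) / 2 + r, (w + v) / 2 - r) =
      ENNReal.ofReal 2 * ∫⁻ x, K (x, x - 2 * r) := by
    intro r
    have := lintegral_comp_mul_add (fun x => K (x, x - 2 * r)) (c := 2⁻¹) (by norm_num) (w / 2 + r)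
    rw [inv_inv, abs_of_pos (by norm_num)] at this
    rw [← this]
    refine lintegral_congr fun v => ?_
    congr 2 <;> ring
  have h3 : ∀ x : ℝ, ∫⁻ r, K (x, x - 2 * r) = ENNReal.ofReal 2⁻¹ * ∫⁻ y, K (x, y) := by
    intro x
    have := lintegral_comp_mul_add (fun y => K (x, y)) (c := -2) (by norm_num) x
    rw [show |(-2 : ℝ)⁻¹| = 2⁻¹ by norm_num [abs_of_pos]] at this
    rw [← this]
    refine lintegral_congr fun r => ?_
    congr 2
    ring
  simp_rw [h1]
  rw [lintegral_lintegral_swap (f := fun v r => K ((w + v) / 2 + r, (w + v) / 2 - r)) (by fun_prop)]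
  simp_rw [h2]
  rw [lintegral_const_mul' _ _ (by simp), lintegral_lintegral_swap
    (f := fun r x => K (x, x - 2 * r)) (by fun_prop)]
  simp_rw [h3]
  rw [lintegral_const_mul' _ _ (by simp), ← mul_assoc, ← ENNReal.ofReal_mul (by norm_num)]
  norm_num
  rw [← lintegral_indicator measurableSet_Ioi]
  refine lintegral_congr fun x => ?_
  by_cases hx : w < x
  · rw [indicator_of_mem (by exact hx), ← lintegral_indicator measurableSet_Iio]
    refine lintegral_congr fun y => ?_
    simp [hKdef, indicator_apply, hx]
  · rw [indicator_of_notMem (by exact hx)]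
    refine lintegral_eq_zero_of_ae_eq_zero (Eventually.of_forall fun y => ?_)
    simp [hKdef, hx]

/-- The eigenvalues as the roots of the characteristic polynomial. -/
theorem eigMax_eq_and_eigMin_eq (H : Matrix (Fin 2) (Fin 2) ℂ) :
    eigMax H = ((gramEntries H).1 + (gramEntries H).2.1) / 2 +
        √((((gramEntries H).1 - (gramEntries H).2.1) / 2) ^ 2 +
          Complex.normSq (gramEntries H).2.2) ∧
      eigMin H = ((gramEntries H).1 + (gramEntries H).2.1) / 2 -
        √((((gramEntries H).1 - (gramEntries H).2.1) / 2) ^ 2 +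
          Complex.normSq (gramEntries H).2.2) := by
  have htr := (congrArg Matrix.trace (gram_eq_hermitianOfEntries H).symm).trans
    (gram_isHermitian H).trace_eq_sum_eigenvalues
  have hdet := (congrArg Matrix.det (gram_eq_hermitianOfEntries H).symm).trans
    (gram_isHermitian H).det_eq_prod_eigenvalues
  unfold eigMax eigMin
  set x := (gram_isHermitian H).eigenvalues 0
  set y := (gram_isHermitian H).eigenvalues 1
  set w := (gramEntries H).1
  set v := (gramEntries H).2.1
  set u := (gramEntries H).2.2
  have hsum : w + v = x + y := by
    have : ((w + v : ℝ) : ℂ) = ((x + y : ℝ) : ℂ) := by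
      push_cast
      simpa [Matrix.trace_fin_two, hermitianOfEntries, Fin.sum_univ_two] using htr
    exact_mod_cast this
  have hprod : w * v - Complex.normSq u = x * y := by
    have : ((w * v - Complex.normSq u : ℝ) : ℂ) = ((x * y : ℝ) : ℂ) := by
      push_cast
      rw [← Complex.mul_conj]
      simpa [Matrix.det_fin_two, hermitianOfEntries, Fin.prod_univ_two] using hdet
    exact_mod_cast this
  have hdisc : ((w - v) / 2) ^ 2 + Complex.normSq u = ((x - y) / 2) ^ 2 := by
    have : ((w - v) / 2) ^ 2 + Complex.normSq u =
      ((w + v) / 2) ^ 2 - (w * v - Complex.normSq u) := by ring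
    rw [this, hsum, hprod]
    ring
  rw [hdisc, Real.sqrt_sq_eq_abs, hsum, abs_div, abs_two]
  rcases le_total x y with h | h
  · rw [max_eq_right h, min_eq_left h, abs_of_nonpos (sub_nonpos.2 h)]
    constructor <;> ring
  · rw [max_eq_left h, min_eq_right h, abs_of_nonneg (sub_nonneg.2 h)]
    constructor <;> ring

theorem aemeasurable_eigenvalues {Ω : Type*} [MeasurableSpace Ω] {P : Measure Ω}
    {H : Ω → Matrix (Fin 2) (Fin 2) ℂ} (hm : ∀ i j, AEMeasurable (fun ω => H ω i j) P) :
    AEMeasurable (fun ω => (eigMax (H ω), eigMin (H ω))) P := by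
  have := aemeasurable_gramEntries hm
  simp_rw [fun ω => (eigMax_eq_and_eigMin_eq (H ω)).1, fun ω => (eigMax_eq_and_eigMin_eq (H ω)).2]
  have h : Measurable fun p : ℝ × ℝ × ℂ => ((p.1 + p.2.1) / 2 +
    √(((p.1 - p.2.1) / 2) ^ 2 + Complex.normSq p.2.2), (p.1 + p.2.1) / 2 -
    √(((p.1 - p.2.1) / 2) ^ 2 + Complex.normSq p.2.2)) := by fun_prop
  exact h.comp_aemeasurable this

/-- The joint law of the first diagonal entry `w` of `H Hᴴ` and the eigenvalues `x > w > y > 0`,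
integrated against a function of the eigenvalues. -/
theorem lintegral_eigenvalues {Ω : Type*} [MeasurableSpace Ω] {P : Measure Ω}
    [IsProbabilityMeasure P] {H : Ω → Matrix (Fin 2) (Fin 2) ℂ} {φ : Fin 2 → Fin 2 → ℝ} {v : ℝ}
    (hpos : ∀ i j, 0 < φ i j)
    (hlaw : ∀ i j, HasLaw (fun ω => H ω i j) (complexGaussian (φ i j)) P)
    (hindep : iIndepFun (fun (p : Fin 2 × Fin 2) (ω : Ω) => H ω p.1 p.2) P)
    (h21 : φ 1 0 = v) (h22 : φ 1 1 = v) (hne : φ 0 0 ≠ φ 0 1)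
    {f : ℝ × ℝ → ENNReal} (hf : Measurable f) :
    ∫⁻ ω, f (eigMax (H ω), eigMin (H ω)) ∂P =
      ∫⁻ w in Ioi 0, ∫⁻ x in Ioi w, ∫⁻ y in Ioo 0 w,
        ENNReal.ofReal (hypoexpDensity (φ 0 0) (φ 0 1) w / w * ((x - y) *
          Real.exp (-(x + y - w) / v) / v ^ 2)) * f (x, y) := by
  have hv : 0 < v := h21 ▸ hpos 1 0
  simp_rw [fun ω => (eigMax_eq_and_eigMin_eq (H ω)).1, fun ω => (eigMax_eq_and_eigMin_eq (H ω)).2]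
  rw [lintegral_gramEntries hpos hlaw hindep h21 h22 hne (F := fun p : ℝ × ℝ × ℂ =>
      f ((p.1 + p.2.1) / 2 + √(((p.1 - p.2.1) / 2) ^ 2 + Complex.normSq p.2.2),
        (p.1 + p.2.1) / 2 - √(((p.1 - p.2.1) / 2) ^ 2 + Complex.normSq p.2.2))) (by fun_prop),
    Measure.volume_eq_prod, lintegral_prod _ (by fun_prop), ← lintegral_indicator measurableSet_Ioi]
  refine lintegral_congr fun w => ?_
  by_cases hw : 0 < w
  · rw [indicator_of_mem (by exact hw), Measure.volume_eq_prod, lintegral_prod _ (by fun_prop)]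
    set κ := hypoexpDensity (φ 0 0) (φ 0 1) w
    have hGset : MeasurableSet {p : ℝ × ℝ | 0 < p.2} :=
      measurableSet_lt measurable_const measurable_snd
    have hGm : Measurable ({p : ℝ × ℝ | 0 < p.2}.indicator fun p : ℝ × ℝ =>
      ENNReal.ofReal (κ / w * (Real.exp (-(p.1 + p.2 - w) / v) / v ^ 2)) * f p) :=
      Measurable.indicator (by fun_prop) hGset
    -- the density of the entries as a function of the eigenvalues, up to the factor `π` which
    -- polar coordinates for the off-diagonal entry absorb
    set G : ℝ × ℝ → ENNReal := {p : ℝ × ℝ | 0 < p.2}.indicator fun p : ℝ × ℝ =>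
      ENNReal.ofReal (κ / w * (Real.exp (-(p.1 + p.2 - w) / v) / v ^ 2)) * f p with hGdef
    have hA : ∀ v' : ℝ, ∫⁻ u : ℂ, ENNReal.ofReal (gramEntriesDensity (φ 0 0) (φ 0 1) v (w, v', u)) *
        f ((w + v') / 2 + √(((w - v') / 2) ^ 2 + Complex.normSq u),
          (w + v') / 2 - √(((w - v') / 2) ^ 2 + Complex.normSq u)) =
        ∫⁻ σ in Ioi 0, G ((w + v') / 2 + √(((w - v') / 2) ^ 2 + σ),
          (w + v') / 2 - √(((w - v') / 2) ^ 2 + σ)) := by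
      intro v'
      have hB := lintegral_comp_normSq (G := fun σ => ENNReal.ofReal Real.pi⁻¹ *
        G ((w + v') / 2 + √(((w - v') / 2) ^ 2 + σ),
          (w + v') / 2 - √(((w - v') / 2) ^ 2 + σ)) ) (by fun_prop)
      conv_rhs at hB =>
        rw [lintegral_const_mul' _ _ (by simp), ← mul_assoc, ← ENNReal.ofReal_mul Real.pi_nonneg,
          mul_inv_cancel₀ Real.pi_ne_zero, ENNReal.ofReal_one, one_mul]
      rw [← hB]
      refine lintegral_congr fun u => ?_
      have hσ := Complex.normSq_nonneg u
      set σ := Complex.normSq u with hσdef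
      -- the smaller eigenvalue is positive iff the determinant `w * v' - σ` is
      have hiff : σ < w * v' ↔ 0 < (w + v') / 2 - √(((w - v') / 2) ^ 2 + σ) := by
        rw [sub_pos]
        constructor
        · intro h
          have hv' : 0 < v' := pos_of_mul_pos_right (hσ.trans_lt h) hw.le
          rw [Real.sqrt_lt' (by positivity)]
          linarith
        · intro h
          have h0 : 0 < (w + v') / 2 := (Real.sqrt_nonneg _).trans_lt h
          rw [Real.sqrt_lt' h0] at h
          linarith
      by_cases h : σ < w * v'
      · rw [gramEntriesDensity, indicator_of_mem (by exact ⟨hw, h⟩), hGdef,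
          indicator_of_mem (by exact hiff.1 h), ← mul_assoc,
          ← ENNReal.ofReal_mul (inv_nonneg.2 Real.pi_nonneg)]
        congr 2
        simp only
        rw [show -((w + v') / 2 + √(((w - v') / 2) ^ 2 + σ) +
          ((w + v') / 2 - √(((w - v') / 2) ^ 2 + σ)) - w) / v = -v' / v by ring]
        field_simp
        rfl
      · rw [gramEntriesDensity, indicator_of_notMem (by exact fun h' => h h'.2), hGdef,
          indicator_of_notMem (by exact fun h' => h (hiff.2 h'))]
        simp
    simp only
    simp_rw [hA]
    rw [lintegral_comp_eigenvalues hGm]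
    refine setLIntegral_congr_fun measurableSet_Ioi fun x hx => ?_
    rw [← lintegral_indicator measurableSet_Ioo, ← lintegral_indicator measurableSet_Iio]
    refine lintegral_congr fun y => ?_
    by_cases hy : y < w <;> by_cases hy0 : 0 < y
    · rw [indicator_of_mem (by exact hy), indicator_of_mem (by exact ⟨hy0, hy⟩), hGdef,
        indicator_of_mem (by exact hy0), ← mul_assoc,
        ← ENNReal.ofReal_mul (sub_nonneg.2 (hy.trans (mem_Ioi.1 hx)).le)]
      congr 2
      simp only
      ring
    all_goals simp [indicator_apply, hy, hy0, hGdef]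
  · rw [indicator_of_notMem (by exact hw)]
    refine lintegral_eq_zero_of_ae_eq_zero (Eventually.of_forall fun q => ?_)
    simp only [Pi.zero_apply]
    rw [gramEntriesDensity, indicator_of_notMem (by exact fun h => hw h.1)]
    simp

/-! ### The exponential integral -/

/-- The entire part `∫₀ˣ (e^t - 1) / t dt` of the exponential integral `Ei x`. -/
noncomputable def eiEntire (x : ℝ) : ℝ := ∫ t in (0 : ℝ)..x, dslope Real.exp 0 t

theorem continuous_dslope_exp : Continuous (dslope Real.exp 0) := by
  rw [← continuousOn_univ, continuousOn_dslope univ_mem]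
  exact ⟨Real.continuous_exp.continuousOn, Real.differentiable_exp 0⟩

theorem hasDerivAt_eiEntire (x : ℝ) : HasDerivAt eiEntire (dslope Real.exp 0 x) x :=
  continuous_dslope_exp.integral_hasStrictDerivAt 0 x |>.hasDerivAt

@[fun_prop]
theorem continuous_eiEntire : Continuous eiEntire :=
  continuous_iff_continuousAt.2 fun x => (hasDerivAt_eiEntire x).continuousAt

theorem eiEntire_zero : eiEntire 0 = 0 := intervalIntegral.integral_same

theorem hasDerivAt_eiEntire_mul (a : ℝ) {w : ℝ} (hw : w ≠ 0) :
    HasDerivAt (fun w => eiEntire (a * w)) ((Real.exp (a * w) - 1) / w) w := by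
  have h := (hasDerivAt_eiEntire (a * w)).comp w ((hasDerivAt_id w).const_mul a)
  refine h.congr_deriv ?_
  rcases eq_or_ne a 0 with rfl | ha
  · simp
  · rw [dslope_of_ne _ (mul_ne_zero ha hw), slope_def_field]
    simp
    field_simp

theorem hasDerivAt_log_add_eiEntire_neg {t : ℝ} (ht : t ≠ 0) :
    HasDerivAt (fun t => Real.log t + eiEntire (-t)) (Real.exp (-t) / t) t := by
  have h := (Real.hasDerivAt_log ht).add (hasDerivAt_eiEntire_mul (-1) ht)
  simp only [neg_one_mul] at h
  refine h.congr_deriv ?_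
  field_simp
  ring

theorem integrableOn_exp_neg_div {y : ℝ} (hy : 0 < y) :
    IntegrableOn (fun t => Real.exp (-t) / t) (Ioi y) := by
  refine Integrable.mono' ((integrableOn_exp_neg_Ioi y).const_mul y⁻¹) ?_ ?_
  · exact (by fun_prop : Measurable fun t => Real.exp (-t) / t).aestronglyMeasurable
  · refine (ae_restrict_mem measurableSet_Ioi).mono fun t ht => ?_
    have ht' : y < t := ht
    have ht0 := hy.trans ht'
    rw [Real.norm_of_nonneg (by positivity), div_eq_inv_mul]
    gcongr

theorem Ei_of_neg {x : ℝ} (hx : x < 0) : Ei x = -∫ t in Ioi (-x), Real.exp (-t) / t := by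
  unfold Ei
  congr 1
  refine Tendsto.limUnder_eq (tendsto_const_nhds.congr' ?_)
  have hx' : 0 < -x := neg_pos.2 hx
  filter_upwards [Ioo_mem_nhdsGT hx'] with δ hδ
  have : {t : ℝ | -x < t ∧ δ < |t|} = Ioi (-x) := by
    ext t
    simp only [mem_ofPred_eq, mem_Ioi, and_iff_left_iff_imp]
    exact fun h => (hδ.2.trans h).trans_le (le_abs_self t)
  rw [this]

theorem intervalIntegral_exp_neg_div {a b : ℝ} (h : (0 : ℝ) ∉ uIcc a b) :
    ∫ t in a..b, Real.exp (-t) / t =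
      Real.log b + eiEntire (-b) - (Real.log a + eiEntire (-a)) := by
  have hne : ∀ t ∈ uIcc a b, t ≠ 0 := fun t ht h0 => h (h0 ▸ ht)
  refine intervalIntegral.integral_eq_sub_of_hasDerivAt
    (fun t ht => hasDerivAt_log_add_eiEntire_neg (hne t ht)) ?_
  refine ContinuousOn.intervalIntegrable fun t ht => ?_
  exact ContinuousAt.continuousWithinAt (by
    have := hne t ht
    fun_prop (disch := assumption))

/-- The additive constant in `Ei x = eiConst + log |x| + ∫₀ˣ (e^t - 1) / t dt`
(it is Euler's constant, but its value plays no role). -/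
noncomputable def eiConst : ℝ := -(∫ t in Ioi 1, Real.exp (-t) / t) - eiEntire (-1)

theorem setIntegral_Ioi_exp_neg_div {y : ℝ} (hy : 0 < y) :
    ∫ t in Ioi y, Real.exp (-t) / t = -(eiConst + Real.log y + eiEntire (-y)) := by
  have h0 : (0 : ℝ) ∉ uIcc y 1 := fun h => by
    have : min y 1 ≤ 0 := h.1
    rcases min_le_iff.1 this with h | h <;> linarith
  have h := intervalIntegral.integral_Ioi_sub_Ioi' (integrableOn_exp_neg_div hy)
    (integrableOn_exp_neg_div one_pos)
  rw [intervalIntegral_exp_neg_div h0, Real.log_one] at h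
  rw [eiConst]
  linarith

theorem Ei_eq {x : ℝ} (hx : x ≠ 0) : Ei x = eiConst + Real.log x + eiEntire x := by
  rcases hx.lt_or_gt with hx | hx
  · rw [Ei_of_neg hx, setIntegral_Ioi_exp_neg_div (neg_pos.2 hx), neg_neg, neg_neg, Real.log_neg_eq_log]
  · rw [Ei, neg_eq_iff_eq_neg]
    refine Tendsto.limUnder_eq ?_
    -- the terms `log δ` from the two sides of the pole cancel
    have hlim : Tendsto (fun δ : ℝ => -(eiConst + Real.log x + eiEntire x) +
        (eiEntire δ - eiEntire (-δ))) (𝓝[>] 0) (𝓝 (-(eiConst + Real.log x + eiEntire x))) := by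
      have : Continuous (fun δ : ℝ => -(eiConst + Real.log x + eiEntire x) +
        (eiEntire δ - eiEntire (-δ))) := by fun_prop
      have h := this.tendsto 0
      simp only [neg_zero, sub_self, add_zero] at h
      exact h.mono_left nhdsWithin_le_nhds
    refine hlim.congr' ?_
    filter_upwards [Ioo_mem_nhdsGT hx] with δ hδ
    have hδ0 : 0 < δ := hδ.1
    have hset : {t : ℝ | -x < t ∧ δ < |t|} = Ioo (-x) (-δ) ∪ Ioi δ := by
      ext t
      simp only [mem_ofPred_eq, mem_union, mem_Ioo, mem_Ioi, lt_abs]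
      constructor
      · rintro ⟨h1, h2 | h2⟩
        · exact Or.inr h2
        · exact Or.inl ⟨h1, by linarith⟩
      · rintro (⟨h1, h2⟩ | h)
        · exact ⟨h1, Or.inr (by linarith)⟩
        · exact ⟨by linarith, Or.inl h⟩
    have hdisj : Disjoint (Ioo (-x) (-δ)) (Ioi δ) := by
      rw [Set.disjoint_left]
      rintro t ⟨_, h1⟩ h2
      have : δ < t := h2
      linarith
    have hle : -x ≤ -δ := neg_le_neg hδ.2.le
    have h0 : (0 : ℝ) ∉ uIcc (-x) (-δ) := fun h => by
      rw [uIcc_of_le hle] at h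
      linarith [h.2]
    have hint : IntegrableOn (fun t => Real.exp (-t) / t) (Ioo (-x) (-δ)) := by
      refine (ContinuousOn.integrableOn_Icc fun t ht => ?_).mono_set Ioo_subset_Icc_self
      have ht0 : t ≠ 0 := fun h => by
        have := ht.2
        linarith
      exact ContinuousAt.continuousWithinAt (by fun_prop (disch := assumption))
    rw [hset, setIntegral_union hdisj measurableSet_Ioi hint (integrableOn_exp_neg_div hδ0),
      ← integral_Ioc_eq_integral_Ioo, ← intervalIntegral.integral_of_le hle,
      intervalIntegral_exp_neg_div h0, setIntegral_Ioi_exp_neg_div hδ0, neg_neg, neg_neg,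
      Real.log_neg_eq_log, Real.log_neg_eq_log]
    ring

theorem tendsto_Ei_atBot : Tendsto Ei atBot (𝓝 0) := by
  have h1 : Tendsto (fun x : ℝ => -Real.exp x) atBot (𝓝 0) := by
    simpa using Real.tendsto_exp_atBot.neg
  refine tendsto_of_tendsto_of_tendsto_of_le_of_le' h1 tendsto_const_nhds ?_ ?_
  · filter_upwards [eventually_le_atBot (-1 : ℝ)] with x hx
    rw [Ei_of_neg (by linarith), neg_le_neg_iff, ← neg_neg x, ← integral_exp_neg_Ioi, neg_neg]
    refine setIntegral_mono_on (integrableOn_exp_neg_div (by linarith))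
      (integrableOn_exp_neg_Ioi _) measurableSet_Ioi fun t ht => ?_
    have : -x < t := ht
    exact div_le_self (Real.exp_pos _).le (by linarith)
  · filter_upwards [eventually_le_atBot (-1 : ℝ)] with x hx
    rw [Ei_of_neg (by linarith), neg_nonpos]
    refine setIntegral_nonneg measurableSet_Ioi fun t ht => ?_
    have : -x < t := ht
    have : 0 < t := by linarith
    positivity

theorem hasDerivAt_Ei_mul {a w : ℝ} (ha : a ≠ 0) (hw : w ≠ 0) :
    HasDerivAt (fun w => Ei (a * w)) (Real.exp (a * w) / w) w := by
  have h := ((Real.hasDerivAt_log hw).const_add (eiConst + Real.log a)).add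
    (hasDerivAt_eiEntire_mul a hw)
  refine (h.congr_of_eventuallyEq ?_).congr_deriv ?_
  · filter_upwards [isOpen_ne.mem_nhds hw] with t ht
    rw [Ei_eq (mul_ne_zero ha ht), Real.log_mul ha ht, Pi.add_apply]
    ring
  · field_simp
    ring

/-! ### The joint density of the eigenvalues -/

/-- The function `g(x) = Ei((1/v - 1/β) x) - Ei((1/v - 1/α) x)` with `Ei` replaced by its entire
part. For `v ∉ {α, β}` it differs from `g` by a constant on `x > 0`; it is continuous in `v > 0`. -/
noncomputable def gEntire (α β v x : ℝ) : ℝ :=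
  eiEntire ((1 / v - 1 / β) * x) - eiEntire ((1 / v - 1 / α) * x)

@[fun_prop]
theorem continuous_gEntire (α β v : ℝ) : Continuous (gEntire α β v) := by
  unfold gEntire
  fun_prop

theorem gEntire_swap (α β v x : ℝ) : gEntire β α v x = -gEntire α β v x := by
  unfold gEntire
  ring

theorem exp_one_div_sub_mul (v β w : ℝ) :
    Real.exp ((1 / v - 1 / β) * w) = Real.exp (-w / β) * Real.exp (w / v) := by
  rw [← Real.exp_add]
  congr 1
  ring

/-- The derivative of `g` is, up to the factor `β - α`, the weight with which the first diagonal
entry `w` enters the joint law of `w` and the eigenvalues. -/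
theorem hasDerivAt_gEntire {α β : ℝ} (hne : α ≠ β) (v : ℝ) {w : ℝ} (hw : w ≠ 0) :
    HasDerivAt (gEntire α β v) ((β - α) * (hypoexpDensity α β w / w * Real.exp (w / v))) w := by
  have hd : β - α ≠ 0 := sub_ne_zero.2 hne.symm
  refine ((hasDerivAt_eiEntire_mul _ hw).sub (hasDerivAt_eiEntire_mul _ hw)).congr_deriv ?_
  rw [exp_one_div_sub_mul, exp_one_div_sub_mul, hypoexpDensity]
  field_simp
  ring

/-- The joint density of the ordered eigenvalues, for every `v > 0`: the determinant of the values
of `g` is written with `gEntire` in place of `g`. -/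
noncomputable def orderedEigenvalueDensity (α β v : ℝ) : ℝ × ℝ → ℝ :=
  eigDensity α β v fun l => gEntire α β v (l 1) - gEntire α β v (l 0)

theorem orderedEigenvalueDensity_apply {α β v : ℝ} {x y : ℝ} (hyx : y ≤ x) (hy : 0 < y) :
    orderedEigenvalueDensity α β v (x, y) = (x - y) * Real.exp (-(x + y) / v) / v ^ 2 *
      ((gEntire α β v x - gEntire α β v y) / (β - α)) := by
  rw [orderedEigenvalueDensity, eigDensity, indicator_of_mem (by exact ⟨hyx, hy⟩)]
  simp only [detPow, Matrix.det_fin_two, Matrix.of_apply, Matrix.cons_val_zero, Matrix.cons_val_one,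
    Fin.val_zero, Fin.val_one, pow_zero, pow_one, div_eq_mul_inv, mul_inv]
  ring

theorem orderedEigenvalueDensity_swap (α β v : ℝ) :
    orderedEigenvalueDensity β α v = orderedEigenvalueDensity α β v := by
  funext p
  obtain ⟨x, y⟩ := p
  by_cases h : y ≤ x ∧ 0 < y
  · rw [orderedEigenvalueDensity_apply h.1 h.2, orderedEigenvalueDensity_apply h.1 h.2,
      gEntire_swap, gEntire_swap α β, ← neg_sub β α, sub_neg_eq_add, neg_add_eq_sub, ← neg_sub
      (gEntire α β v x), neg_div_neg_eq]
  · rw [orderedEigenvalueDensity, orderedEigenvalueDensity, eigDensity, eigDensity,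
      indicator_of_notMem (by exact h), indicator_of_notMem (by exact h)]

/-- Integrating out the first diagonal entry gives the joint density of the eigenvalues. -/
theorem setLIntegral_diagonal_entry {α β v x y : ℝ} (hα : 0 < α) (hβ : 0 < β) (hne : α ≠ β)
    (hyx : y ≤ x) (hy : 0 < y) :
    ∫⁻ w in Ioo y x, ENNReal.ofReal (hypoexpDensity α β w / w *
      ((x - y) * Real.exp (-(x + y - w) / v) / v ^ 2)) =
      ENNReal.ofReal (orderedEigenvalueDensity α β v (x, y)) := by
  have hd : β - α ≠ 0 := sub_ne_zero.2 hne.symm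
  rw [orderedEigenvalueDensity_apply hyx hy, sub_div, mul_sub]
  refine And.right <| setLIntegral_Ioo_ofReal_deriv
    (F := fun w => (x - y) * Real.exp (-(x + y) / v) / v ^ 2 * (gEntire α β v w / (β - α))) hyx (by fun_prop) (fun w hw => ?_) (fun w hw => ?_)
  · have hw0 : w ≠ 0 := (hy.trans hw.1).ne'
    refine (((hasDerivAt_gEntire hne v hw0).div_const _).const_mul _).congr_deriv ?_
    have : Real.exp (-(x + y - w) / v) = Real.exp (-(x + y) / v) * Real.exp (w / v) := by
      rw [← Real.exp_add]
      congr 1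
      ring
    rw [this]
    field_simp
  · have hw0 : 0 < w := hy.trans hw.1
    have := hypoexpDensity_nonneg hα hβ hw0.le
    have := sub_nonneg.2 hyx
    positivity

theorem lintegral_eigenvalues_density {α β v : ℝ} (hα : 0 < α) (hβ : 0 < β) (hne : α ≠ β)
    {f : ℝ × ℝ → ENNReal} (hf : Measurable f) :
    ∫⁻ w in Ioi 0, ∫⁻ x in Ioi w, ∫⁻ y in Ioo 0 w,
        ENNReal.ofReal (hypoexpDensity α β w / w * ((x - y) *
          Real.exp (-(x + y - w) / v) / v ^ 2)) * f (x, y) =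
      ∫⁻ p : ℝ × ℝ, ENNReal.ofReal (orderedEigenvalueDensity α β v p) * f p := by
  have hT : MeasurableSet {q : ℝ × ℝ × ℝ | (0 < q.2.2 ∧ q.2.2 < q.1) ∧ q.1 < q.2.1} :=
    ((measurableSet_lt measurable_const measurable_snd.snd).inter
      (measurableSet_lt measurable_snd.snd measurable_fst)).inter
      (measurableSet_lt measurable_fst measurable_snd.fst)
  have hKm : Measurable ({q : ℝ × ℝ × ℝ | (0 < q.2.2 ∧ q.2.2 < q.1) ∧ q.1 < q.2.1}.indicator
      fun q => ENNReal.ofReal (hypoexpDensity α β q.1 / q.1 * ((q.2.1 - q.2.2) *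
          Real.exp (-(q.2.1 + q.2.2 - q.1) / v) / v ^ 2)) * f q.2) :=
    Measurable.indicator (by fun_prop) hT
  set K : ℝ × ℝ × ℝ → ENNReal :=
    {q : ℝ × ℝ × ℝ | (0 < q.2.2 ∧ q.2.2 < q.1) ∧ q.1 < q.2.1}.indicator
      fun q => ENNReal.ofReal (hypoexpDensity α β q.1 / q.1 * ((q.2.1 - q.2.2) *
          Real.exp (-(q.2.1 + q.2.2 - q.1) / v) / v ^ 2)) * f q.2 with hK
  have hK0 : ∀ w x y : ℝ, ¬((0 < y ∧ y < w) ∧ w < x) → K (w, x, y) = 0 := fun w x y h =>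
    indicator_of_notMem (by exact h) _
  have h1 : ∫⁻ w in Ioi 0, ∫⁻ x in Ioi w, ∫⁻ y in Ioo 0 w,
        ENNReal.ofReal (hypoexpDensity α β w / w * ((x - y) *
          Real.exp (-(x + y - w) / v) / v ^ 2)) * f (x, y) = ∫⁻ w, ∫⁻ p : ℝ × ℝ, K (w, p) := by
    rw [← lintegral_indicator measurableSet_Ioi]
    refine lintegral_congr fun w => ?_
    rw [Measure.volume_eq_prod, lintegral_prod _ (by fun_prop)]
    by_cases hw : 0 < w
    · rw [indicator_of_mem (by exact hw), ← lintegral_indicator measurableSet_Ioi]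
      refine lintegral_congr fun x => ?_
      by_cases hx : w < x
      · rw [indicator_of_mem (by exact hx), ← lintegral_indicator measurableSet_Ioo]
        refine lintegral_congr fun y => ?_
        by_cases hy : 0 < y ∧ y < w
        · rw [indicator_of_mem (by exact hy), hK, indicator_of_mem (by exact ⟨hy, hx⟩)]
        · rw [indicator_of_notMem (by exact hy), hK0 _ _ _ fun h => hy h.1]
      · rw [indicator_of_notMem (by exact hx)]
        simp_rw [hK0 w x _ fun h => hx h.2]
        simp
    · rw [indicator_of_notMem (by exact hw)]
      simp_rw [hK0 w _ _ fun h => hw (h.1.1.trans h.1.2)]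
      simp
  rw [h1, lintegral_lintegral_swap (f := fun w p => K (w, p)) (by fun_prop)]
  refine lintegral_congr fun p => ?_
  obtain ⟨x, y⟩ := p
  by_cases h : y ≤ x ∧ 0 < y
  · rw [← setLIntegral_diagonal_entry hα hβ hne h.1 h.2, ← lintegral_mul_const _ (by fun_prop),
      ← lintegral_indicator measurableSet_Ioo]
    refine lintegral_congr fun w => ?_
    by_cases hw : y < w ∧ w < x
    · rw [indicator_of_mem (by exact hw), hK, indicator_of_mem (by exact ⟨⟨h.2, hw.1⟩, hw.2⟩)]
    · rw [indicator_of_notMem (by exact hw), hK0 _ _ _ fun h' => hw ⟨h'.1.2, h'.2⟩]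
  · have h0 : orderedEigenvalueDensity α β v (x, y) = 0 := by
      rw [orderedEigenvalueDensity, eigDensity, indicator_of_notMem (by exact h)]
    simp_rw [hK0 _ x y fun h' => h ⟨(h'.1.2.trans h'.2).le, h'.1.1⟩]
    simp [h0]

theorem orderedEigenvalueDensity_nonneg {α β v : ℝ} (hα : 0 < α) (hβ : 0 < β) (hne : α ≠ β)
    (p : ℝ × ℝ) : 0 ≤ orderedEigenvalueDensity α β v p := by
  obtain ⟨x, y⟩ := p
  by_cases h : y ≤ x ∧ 0 < y
  · wlog hlt : α < β generalizing α β
    · rw [← orderedEigenvalueDensity_swap]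
      exact this hβ hα hne.symm (lt_of_le_of_ne (not_lt.1 hlt) hne.symm)
    rw [orderedEigenvalueDensity_apply h.1 h.2]
    have hmono : gEntire α β v y ≤ gEntire α β v x := by
      have hpos : Ici y ⊆ {t | t ≠ 0} := fun t ht => (h.2.trans_le ht).ne'
      refine (monotoneOn_of_deriv_nonneg (convex_Ici y) (by fun_prop) (fun t ht => ?_)
        fun t ht => ?_) self_mem_Ici h.1 h.1
      · exact (hasDerivAt_gEntire hne v
          (hpos (interior_subset ht))).differentiableAt.differentiableWithinAt
      · have ht0 : 0 < t := h.2.trans_le (interior_subset ht)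
        rw [(hasDerivAt_gEntire hne v ht0.ne').deriv]
        have := hypoexpDensity_nonneg hα hβ ht0.le
        have := sub_pos.2 hlt
        positivity
    have := sub_nonneg.2 h.1
    have := sub_nonneg.2 hmono
    have := sub_pos.2 hlt
    positivity
  · rw [orderedEigenvalueDensity, eigDensity, indicator_of_notMem (by exact h)]

theorem measurable_orderedEigenvalueDensity (α β v : ℝ) :
    Measurable (orderedEigenvalueDensity α β v) := by
  refine Measurable.indicator ?_ ?_
  · simp [detPow, Matrix.det_fin_two]
    fun_prop
  · exact (measurableSet_le measurable_snd measurable_fst).inter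
      (measurableSet_lt measurable_const measurable_snd)

theorem hasDensity_eigenvalues {Ω : Type*} [MeasurableSpace Ω] {P : Measure Ω}
    [IsProbabilityMeasure P] {H : Ω → Matrix (Fin 2) (Fin 2) ℂ} {φ : Fin 2 → Fin 2 → ℝ} {v : ℝ}
    (hpos : ∀ i j, 0 < φ i j)
    (hlaw : ∀ i j, HasLaw (fun ω => H ω i j) (complexGaussian (φ i j)) P)
    (hindep : iIndepFun (fun (p : Fin 2 × Fin 2) (ω : Ω) => H ω p.1 p.2) P)
    (h21 : φ 1 0 = v) (h22 : φ 1 1 = v) (hne : φ 0 0 ≠ φ 0 1) :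
    HasDensity (fun ω => (eigMax (H ω), eigMin (H ω))) P volume
      (orderedEigenvalueDensity (φ 0 0) (φ 0 1) v) := by
  have hm := aemeasurable_eigenvalues fun i j => (hlaw i j).aemeasurable
  have hd := measurable_orderedEigenvalueDensity (φ 0 0) (φ 0 1) v
  refine ⟨hm, orderedEigenvalueDensity_nonneg (hpos 0 0) (hpos 0 1) hne, hd.aemeasurable,
    Measure.ext_of_lintegral _ fun f hf => ?_⟩
  rw [lintegral_map' hf.aemeasurable hm, lintegral_withDensity_eq_lintegral_mul _ (by fun_prop) hf,
    lintegral_eigenvalues hpos hlaw hindep h21 h22 hne hf,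
    lintegral_eigenvalues_density (hpos 0 0) (hpos 0 1) hne hf]
  rfl

/-- The logarithmic parts of the four values of `Ei` cancel in the determinant. -/
theorem detG_eq {φ₁ φ₂ r : ℝ} (h1 : r ≠ φ₁) (h2 : r ≠ φ₂) {l : Fin 2 → ℝ} (h01 : l 1 ≤ l 0)
    (hl : 0 < l 1) : detG φ₁ φ₂ r l = gEntire φ₁ φ₂ r (l 1) - gEntire φ₁ φ₂ r (l 0) := by
  have ha : 1 / r - 1 / φ₁ ≠ 0 := fun h => h1 (by simpa [sub_eq_zero] using h)
  have hb : 1 / r - 1 / φ₂ ≠ 0 := fun h => h2 (by simpa [sub_eq_zero] using h)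
  have hl0 : l 0 ≠ 0 := (hl.trans_le h01).ne'
  simp only [detG, Matrix.det_fin_two, Matrix.of_apply, gFun, gEntire, Fin.val_zero, Fin.val_one,
    pow_zero, pow_one, one_mul]
  rw [Ei_eq (mul_ne_zero hb hl0), Ei_eq (mul_ne_zero ha hl0), Ei_eq (mul_ne_zero hb hl.ne'),
    Ei_eq (mul_ne_zero ha hl.ne'), Real.log_mul hb hl0, Real.log_mul ha hl0, Real.log_mul hb hl.ne',
    Real.log_mul ha hl.ne']
  ring

theorem tendsto_detG {φ₁ φ₂ φ₃ : ℝ} (h3 : φ₃ ≠ 0) {l : Fin 2 → ℝ} (h01 : l 1 ≤ l 0)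
    (hl : 0 < l 1) :
    Tendsto (fun r => detG φ₁ φ₂ r l) (𝓝[({φ₁, φ₂} : Set ℝ)ᶜ] φ₃)
      (𝓝 (gEntire φ₁ φ₂ φ₃ (l 1) - gEntire φ₁ φ₂ φ₃ (l 0))) := by
  have hc : ContinuousAt (fun r => gEntire φ₁ φ₂ r (l 1) - gEntire φ₁ φ₂ r (l 0)) φ₃ := by
    unfold gEntire
    fun_prop (disch := assumption)
  refine (hc.tendsto.mono_left nhdsWithin_le_nhds).congr' ?_
  filter_upwards [self_mem_nhdsWithin] with r hr
  simp only [mem_compl_iff, mem_insert_iff, mem_singleton_iff, not_or] at hr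
  exact (detG_eq hr.1 hr.2 h01 hl).symm

theorem eigDensity_detG {φ₁ φ₂ φ₃ : ℝ} (h1 : φ₃ ≠ φ₁) (h2 : φ₃ ≠ φ₂) :
    eigDensity φ₁ φ₂ φ₃ (detG φ₁ φ₂ φ₃) = orderedEigenvalueDensity φ₁ φ₂ φ₃ := by
  refine indicator_congr fun p hp => ?_
  rw [detG_eq h1 h2 (l := ![p.1, p.2]) hp.1 hp.2]

/-! ### The distribution functions of the extreme eigenvalues -/

/-- Integrating out the smaller eigenvalue `y`; the primitive in `y` is
`e^{-(x + y - w) / v} (1 - (x - y) / v)`. -/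
theorem setLIntegral_smaller_eigenvalue {v c L w x : ℝ} (hv : 0 < v) (hc : 0 ≤ c) (hL : L ≤ w)
    (hx : w < x) :
    0 ≤ c * (Real.exp (-x / v) * (1 - (x - w) / v) -
        Real.exp (-(x + L - w) / v) * (1 - (x - L) / v)) ∧
      ∫⁻ y in Ioo L w, ENNReal.ofReal (c * ((x - y) * Real.exp (-(x + y - w) / v) / v ^ 2)) =
        ENNReal.ofReal (c * (Real.exp (-x / v) * (1 - (x - w) / v) -
          Real.exp (-(x + L - w) / v) * (1 - (x - L) / v))) := by
  have h := setLIntegral_Ioo_ofReal_deriv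
    (F := fun y => c * (Real.exp (-(x + y - w) / v) * (1 - (x - y) / v)))
    (F' := fun y => c * ((x - y) * Real.exp (-(x + y - w) / v) / v ^ 2)) hL (by fun_prop)
    (fun y _ => by
      have h1 : HasDerivAt (fun y => Real.exp (-(x + y - w) / v))
          (Real.exp (-(x + y - w) / v) * (-1 / v)) y :=
        ((((hasDerivAt_id y).const_add x).sub_const w).neg.div_const v).exp
      have h2 : HasDerivAt (fun y => 1 - (x - y) / v) (-(-1 / v)) y :=
        (((hasDerivAt_id y).const_sub x).div_const v).const_sub 1
      refine ((h1.mul h2).const_mul c).congr_deriv ?_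
      field_simp
      ring)
    (fun y hy => by
      have : 0 ≤ x - y := by linarith [hy.2]
      positivity)
  simpa only [add_sub_cancel_right, ← mul_sub] using h

/-- A primitive in `x` of the value found in `setLIntegral_smaller_eigenvalue`. -/
theorem hasDerivAt_larger_eigenvalue_primitive {v : ℝ} (hv : 0 < v) (c L w x : ℝ) :
    HasDerivAt (fun x => c * (Real.exp (-x / v) * (x - w) - Real.exp (-(x + L - w) / v) * (x - L)))
      (c * (Real.exp (-x / v) * (1 - (x - w) / v) -
          Real.exp (-(x + L - w) / v) * (1 - (x - L) / v))) x := by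
  have h1 : HasDerivAt (fun x => Real.exp (-x / v)) (Real.exp (-x / v) * (-1 / v)) x :=
    ((hasDerivAt_id x).neg.div_const v).exp
  have h2 : HasDerivAt (fun x => Real.exp (-(x + L - w) / v))
      (Real.exp (-(x + L - w) / v) * (-1 / v)) x :=
    ((((hasDerivAt_id x).add_const L).sub_const w).neg.div_const v).exp
  have h3 : HasDerivAt (fun x => x - w) 1 x := (hasDerivAt_id x).sub_const w
  have h4 : HasDerivAt (fun x => x - L) 1 x := (hasDerivAt_id x).sub_const L
  refine (((h1.mul h3).sub (h2.mul h4)).const_mul c).congr_deriv ?_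
  field_simp
  ring

theorem tendsto_exp_neg_div_mul_sub {v : ℝ} (hv : 0 < v) (a b : ℝ) :
    Tendsto (fun x => Real.exp (-(x + a) / v) * (x - b)) atTop (𝓝 0) := by
  have h1 : Tendsto (fun x : ℝ => Real.exp (-x) * x) atTop (𝓝 0) := by
    simpa [mul_comm] using Real.tendsto_pow_mul_exp_neg_atTop_nhds_zero 1
  have hlin : Tendsto (fun x : ℝ => (x + a) / v) atTop atTop :=
    (tendsto_atTop_add_const_right _ a tendsto_id).atTop_div_const hv
  have h2 : Tendsto (fun x : ℝ => Real.exp (-x)) atTop (𝓝 0) :=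
    Real.tendsto_exp_neg_atTop_nhds_zero
  have h3 := ((h1.comp hlin).const_mul v).sub ((h2.comp hlin).const_mul (a + b))
  simp only [mul_zero, sub_zero] at h3
  refine h3.congr fun x => ?_
  simp only [Function.comp]
  rw [neg_div]
  field_simp
  ring

theorem setLIntegral_eigenvalues_Ioi {v c L w : ℝ} (hv : 0 < v) (hc : 0 ≤ c) (hL : L ≤ w) :
    ∫⁻ x in Ioi w, ∫⁻ y in Ioo L w,
        ENNReal.ofReal (c * ((x - y) * Real.exp (-(x + y - w) / v) / v ^ 2)) =
      ENNReal.ofReal (c * (Real.exp (-L / v) * (w - L))) := by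
  rw [setLIntegral_congr_fun measurableSet_Ioi fun x hx =>
    (setLIntegral_smaller_eigenvalue hv hc hL hx).2]
  have hlim : Tendsto (fun x => c * (Real.exp (-x / v) * (x - w) -
      Real.exp (-(x + L - w) / v) * (x - L))) atTop (𝓝 0) := by
    have h1 := tendsto_exp_neg_div_mul_sub hv 0 w
    have h2 := tendsto_exp_neg_div_mul_sub hv (L - w) L
    simp only [add_zero, ← add_sub_assoc] at h1 h2
    simpa using (h1.sub h2).const_mul c
  rw [(setLIntegral_Ioi_ofReal_deriv (fun x _ => hasDerivAt_larger_eigenvalue_primitive hv c L w x)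
    (fun x hx => (setLIntegral_smaller_eigenvalue hv hc hL hx).1) hlim).2]
  congr 1
  rw [add_sub_cancel_left]
  ring

theorem setLIntegral_eigenvalues_Ioo {v c w X : ℝ} (hv : 0 < v) (hc : 0 ≤ c) (hw : 0 ≤ w)
    (hX : w ≤ X) :
    0 ≤ c * (w - X * Real.exp (-(X - w) / v) + (X - w) * Real.exp (-X / v)) ∧
    ∫⁻ x in Ioo w X, ∫⁻ y in Ioo 0 w,
        ENNReal.ofReal (c * ((x - y) * Real.exp (-(x + y - w) / v) / v ^ 2)) =
      ENNReal.ofReal (c * (w - X * Real.exp (-(X - w) / v) + (X - w) * Real.exp (-X / v))) := by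
  rw [setLIntegral_congr_fun measurableSet_Ioo fun x hx =>
    (setLIntegral_smaller_eigenvalue hv hc hw hx.1).2]
  have h := setLIntegral_Ioo_ofReal_deriv hX
    (F := fun x => c * (Real.exp (-x / v) * (x - w) - Real.exp (-(x + 0 - w) / v) * (x - 0)))
    (by fun_prop) (fun x _ => hasDerivAt_larger_eigenvalue_primitive hv c 0 w x)
    (fun x hx => (setLIntegral_smaller_eigenvalue hv hc hw hx.1).1)
  convert h using 2
  · simp
    ring
  · congr 1
    simp
    ring

theorem hasDerivAt_exp_neg_div (β w : ℝ) :
    HasDerivAt (fun w => Real.exp (-w / β)) (Real.exp (-w / β) * (-1 / β)) w :=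
  ((hasDerivAt_id w).neg.div_const β).exp

theorem hasDerivAt_Ei_neg_div {β w : ℝ} (hβ : β ≠ 0) (hw : w ≠ 0) :
    HasDerivAt (fun w => Ei (-w / β)) (Real.exp (-w / β) / w) w := by
  have e : ∀ w : ℝ, -w / β = -β⁻¹ * w := fun w => by ring
  simp only [e]
  exact hasDerivAt_Ei_mul (neg_ne_zero.2 (inv_ne_zero hβ)) hw

theorem hasDerivAt_eiEntire_neg_div {β w : ℝ} (hw : w ≠ 0) :
    HasDerivAt (fun w => eiEntire (-w / β)) ((Real.exp (-w / β) - 1) / w) w := by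
  have e : ∀ w : ℝ, -w / β = -β⁻¹ * w := fun w => by ring
  simp only [e]
  exact hasDerivAt_eiEntire_mul _ hw

theorem tendsto_neg_div_atBot {β : ℝ} (hβ : 0 < β) :
    Tendsto (fun w : ℝ => -w / β) atTop atBot :=
  tendsto_neg_atTop_atBot.atBot_div_const hβ

/-- The probability that the smaller eigenvalue exceeds `X`. -/
noncomputable def eigMinTail (α β v X : ℝ) : ℝ :=
  Real.exp (-X / v) / (β - α) * (β * Real.exp (-X / β) - α * Real.exp (-X / α) +
    X * (Ei (-X / β) - Ei (-X / α)))

/-- The probability that the larger eigenvalue does not exceed `X`, in terms of the entire part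
of `Ei`. -/
noncomputable def eigMaxCDF (α β v X : ℝ) : ℝ :=
  1 / (β - α) * ((1 - Real.exp (-X / v)) *
    (β * (1 - Real.exp (-X / β)) - α * (1 - Real.exp (-X / α))) +
    X * Real.exp (-X / v) * (-gEntire α β v X + eiEntire (-X / β) - eiEntire (-X / α)))

theorem eigMinTail_swap (α β v X : ℝ) : eigMinTail β α v X = eigMinTail α β v X := by
  unfold eigMinTail
  rw [← neg_sub β α, div_neg]
  ring

theorem eigMaxCDF_swap (α β v X : ℝ) : eigMaxCDF β α v X = eigMaxCDF α β v X := by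
  unfold eigMaxCDF
  rw [← neg_sub β α, div_neg, gEntire_swap]
  ring

theorem setLIntegral_eigMinTail {α β v X : ℝ} (hα : 0 < α) (hβ : 0 < β) (hne : α ≠ β)
    (hX : 0 < X) :
    0 ≤ eigMinTail α β v X ∧
    ∫⁻ w in Ioi X, ENNReal.ofReal (hypoexpDensity α β w / w * (Real.exp (-X / v) * (w - X))) =
      ENNReal.ofReal (eigMinTail α β v X) := by
  have hd : β - α ≠ 0 := sub_ne_zero.2 hne.symm
  have h := setLIntegral_Ioi_ofReal_deriv (a := X) (l := 0)
    (F := fun w => Real.exp (-X / v) / (β - α) * (-β * Real.exp (-w / β) + α * Real.exp (-w / α) -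
      X * (Ei (-w / β) - Ei (-w / α))))
    (F' := fun w => hypoexpDensity α β w / w * (Real.exp (-X / v) * (w - X)))
    (fun w hw => by
      have hw0 : w ≠ 0 := (hX.trans_le hw).ne'
      refine (((((hasDerivAt_exp_neg_div β w).const_mul (-β)).add
        ((hasDerivAt_exp_neg_div α w).const_mul α)).sub
        (((hasDerivAt_Ei_neg_div hβ.ne' hw0).sub
          (hasDerivAt_Ei_neg_div hα.ne' hw0)).const_mul X)).const_mul _).congr_deriv ?_
      unfold hypoexpDensity
      field_simp
      ring)
    (fun w hw => by
      have hw' : X < w := hw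
      have hw0 : 0 < w := hX.trans hw'
      have := hypoexpDensity_nonneg hα hβ hw0.le
      have := sub_pos.2 hw'
      positivity)
    (by
      have e : ∀ γ : ℝ, 0 < γ → Tendsto (fun w : ℝ => Real.exp (-w / γ)) atTop (𝓝 0) :=
        fun γ hγ => Real.tendsto_exp_atBot.comp (tendsto_neg_div_atBot hγ)
      have i : ∀ γ : ℝ, 0 < γ → Tendsto (fun w : ℝ => Ei (-w / γ)) atTop (𝓝 0) :=
        fun γ hγ => tendsto_Ei_atBot.comp (tendsto_neg_div_atBot hγ)
      simpa using (((((e β hβ).const_mul (-β)).add ((e α hα).const_mul α)).sub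
        (((i β hβ).sub (i α hα)).const_mul X)).const_mul (Real.exp (-X / v) / (β - α))))
  have he : eigMinTail α β v X = 0 - Real.exp (-X / v) / (β - α) *
      (-β * Real.exp (-X / β) + α * Real.exp (-X / α) - X * (Ei (-X / β) - Ei (-X / α))) := by
    unfold eigMinTail
    ring
  rw [he]
  exact h

theorem setLIntegral_eigMaxCDF {α β v X : ℝ} (hα : 0 < α) (hβ : 0 < β) (hne : α ≠ β) (hv : 0 < v)
    (hX : 0 < X) :
    0 ≤ eigMaxCDF α β v X ∧
    ∫⁻ w in Ioo 0 X, ENNReal.ofReal (hypoexpDensity α β w / w *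
        (w - X * Real.exp (-(X - w) / v) + (X - w) * Real.exp (-X / v))) =
      ENNReal.ofReal (eigMaxCDF α β v X) := by
  have hd : β - α ≠ 0 := sub_ne_zero.2 hne.symm
  have h := setLIntegral_Ioo_ofReal_deriv hX.le
    (F := fun w => 1 / (β - α) * ((1 - Real.exp (-X / v)) *
      (-β * Real.exp (-w / β) + α * Real.exp (-w / α)) +
      X * Real.exp (-X / v) * (-gEntire α β v w + eiEntire (-w / β) - eiEntire (-w / α))))
    (F' := fun w => hypoexpDensity α β w / w *
        (w - X * Real.exp (-(X - w) / v) + (X - w) * Real.exp (-X / v)))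
    (by fun_prop)
    (fun w hw => by
      have hw0 : w ≠ 0 := hw.1.ne'
      refine ((((((hasDerivAt_exp_neg_div β w).const_mul (-β)).add
        ((hasDerivAt_exp_neg_div α w).const_mul α)).const_mul _).add
        ((((hasDerivAt_gEntire hne v hw0).neg.add (hasDerivAt_eiEntire_neg_div hw0)).sub
          (hasDerivAt_eiEntire_neg_div hw0)).const_mul _)).const_mul _).congr_deriv ?_
      have : Real.exp (-(X - w) / v) = Real.exp (-X / v) * Real.exp (w / v) := by
        rw [← Real.exp_add]
        congr 1
        ring
      rw [this]
      unfold hypoexpDensity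
      field_simp
      ring)
    (fun w hw => (setLIntegral_eigenvalues_Ioo hv
      (div_nonneg (hypoexpDensity_nonneg hα hβ hw.1.le) hw.1.le) hw.1.le hw.2.le).1)
  have he : eigMaxCDF α β v X = 1 / (β - α) * ((1 - Real.exp (-X / v)) *
      (-β * Real.exp (-X / β) + α * Real.exp (-X / α)) +
      X * Real.exp (-X / v) * (-gEntire α β v X + eiEntire (-X / β) - eiEntire (-X / α))) -
      1 / (β - α) * ((1 - Real.exp (-X / v)) *
      (-β * Real.exp (-0 / β) + α * Real.exp (-0 / α)) +
      X * Real.exp (-X / v) * (-gEntire α β v 0 + eiEntire (-0 / β) - eiEntire (-0 / α))) := by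
    simp only [eigMaxCDF, gEntire, mul_zero, neg_zero, zero_div, eiEntire_zero, Real.exp_zero]
    ring
  rw [he]
  exact h

section Distribution

variable {Ω : Type*} [MeasurableSpace Ω] {P : Measure Ω}
  [IsProbabilityMeasure P] {H : Ω → Matrix (Fin 2) (Fin 2) ℂ} {φ : Fin 2 → Fin 2 → ℝ} {v : ℝ}

theorem measure_eigenvalues_mem (hpos : ∀ i j, 0 < φ i j)
    (hlaw : ∀ i j, HasLaw (fun ω => H ω i j) (complexGaussian (φ i j)) P)
    (hindep : iIndepFun (fun (p : Fin 2 × Fin 2) (ω : Ω) => H ω p.1 p.2) P)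
    (h21 : φ 1 0 = v) (h22 : φ 1 1 = v) (hne : φ 0 0 ≠ φ 0 1)
    {S : Set (ℝ × ℝ)} (hS : MeasurableSet S) :
    P {ω | (eigMax (H ω), eigMin (H ω)) ∈ S} =
      ∫⁻ w in Ioi 0, ∫⁻ x in Ioi w, ∫⁻ y in Ioo 0 w, S.indicator (fun p =>
        ENNReal.ofReal (hypoexpDensity (φ 0 0) (φ 0 1) w / w * ((p.1 - p.2) *
          Real.exp (-(p.1 + p.2 - w) / v) / v ^ 2))) (x, y) := by
  have hm := aemeasurable_eigenvalues fun i j => (hlaw i j).aemeasurable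
  have h := lintegral_eigenvalues hpos hlaw hindep h21 h22 hne
    (f := S.indicator fun _ => 1) (measurable_const.indicator hS)
  rw [← lintegral_map' (f := S.indicator fun _ => 1) (measurable_const.indicator hS).aemeasurable hm,
    lintegral_indicator hS, setLIntegral_one, Measure.map_apply_of_aemeasurable hm hS] at h
  refine h.trans (lintegral_congr fun w => lintegral_congr fun x => lintegral_congr fun y => ?_)
  by_cases hp : (x, y) ∈ S <;> simp [hp]

theorem measure_lt_eigMin (hpos : ∀ i j, 0 < φ i j)
    (hlaw : ∀ i j, HasLaw (fun ω => H ω i j) (complexGaussian (φ i j)) P)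
    (hindep : iIndepFun (fun (p : Fin 2 × Fin 2) (ω : Ω) => H ω p.1 p.2) P)
    (h21 : φ 1 0 = v) (h22 : φ 1 1 = v) (hne : φ 0 0 ≠ φ 0 1) {X : ℝ} (hX : 0 < X) :
    P {ω | X < eigMin (H ω)} = ENNReal.ofReal (eigMinTail (φ 0 0) (φ 0 1) v X) := by
  have hv : 0 < v := h21 ▸ hpos 1 0
  have hS : MeasurableSet {p : ℝ × ℝ | X < p.2} := measurableSet_lt measurable_const measurable_snd
  have h := measure_eigenvalues_mem hpos hlaw hindep h21 h22 hne hS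
  refine h.trans ?_
  rw [← (setLIntegral_eigMinTail (hpos 0 0) (hpos 0 1) hne hX).2,
    ← lintegral_indicator measurableSet_Ioi, ← lintegral_indicator measurableSet_Ioi]
  refine lintegral_congr fun w => ?_
  by_cases hw : X < w
  · have hw0 : 0 < w := hX.trans hw
    rw [indicator_of_mem (by exact hw0), indicator_of_mem (by exact hw),
      ← setLIntegral_eigenvalues_Ioi hv
        (div_nonneg (hypoexpDensity_nonneg (hpos 0 0) (hpos 0 1) hw0.le) hw0.le) hw.le]
    refine lintegral_congr fun x => ?_
    rw [← lintegral_indicator measurableSet_Ioo, ← lintegral_indicator measurableSet_Ioo]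
    refine lintegral_congr fun y => ?_
    by_cases hy : X < y
    · simp [indicator_apply, hy, hX.trans hy]
    · simp [indicator_apply, hy]
  · rw [indicator_of_notMem (s := Ioi X) (by exact hw), indicator_apply_eq_zero]
    intro _
    refine setLIntegral_eq_zero measurableSet_Ioi fun x _ => ?_
    refine setLIntegral_eq_zero measurableSet_Ioo fun y hy => ?_
    rw [indicator_of_notMem (by exact fun h : X < y => hw (h.trans hy.2))]
    rfl

theorem measure_eigMax_le (hpos : ∀ i j, 0 < φ i j)
    (hlaw : ∀ i j, HasLaw (fun ω => H ω i j) (complexGaussian (φ i j)) P)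
    (hindep : iIndepFun (fun (p : Fin 2 × Fin 2) (ω : Ω) => H ω p.1 p.2) P)
    (h21 : φ 1 0 = v) (h22 : φ 1 1 = v) (hne : φ 0 0 ≠ φ 0 1) {X : ℝ} (hX : 0 < X) :
    P {ω | eigMax (H ω) ≤ X} = ENNReal.ofReal (eigMaxCDF (φ 0 0) (φ 0 1) v X) := by
  have hv : 0 < v := h21 ▸ hpos 1 0
  have hS : MeasurableSet {p : ℝ × ℝ | p.1 ≤ X} := measurableSet_le measurable_fst measurable_const
  have h := measure_eigenvalues_mem hpos hlaw hindep h21 h22 hne hS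
  refine h.trans ?_
  rw [← (setLIntegral_eigMaxCDF (hpos 0 0) (hpos 0 1) hne hv hX).2,
    ← lintegral_indicator measurableSet_Ioi, ← lintegral_indicator measurableSet_Ioo]
  refine lintegral_congr fun w => ?_
  by_cases hw0 : 0 < w
  · by_cases hw : w < X
    · rw [indicator_of_mem (by exact hw0), indicator_of_mem (by exact ⟨hw0, hw⟩),
        ← (setLIntegral_eigenvalues_Ioo hv
          (div_nonneg (hypoexpDensity_nonneg (hpos 0 0) (hpos 0 1) hw0.le) hw0.le) hw0.le hw.le).2,
        setLIntegral_congr Ioo_ae_eq_Ioc, ← lintegral_indicator measurableSet_Ioi,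
        ← lintegral_indicator measurableSet_Ioc]
      refine lintegral_congr fun x => ?_
      by_cases hx : x ≤ X
      · simp [indicator_apply, hx]
      · simp [indicator_apply, hx]
    · rw [indicator_of_mem (by exact hw0), indicator_of_notMem (by exact fun h => hw h.2)]
      refine setLIntegral_eq_zero measurableSet_Ioi fun x hx => ?_
      have hx' : w < x := hx
      refine setLIntegral_eq_zero measurableSet_Ioo fun y _ => ?_
      rw [indicator_of_notMem (by exact fun h : x ≤ X => hw (hx'.trans_le h))]
      rfl
  · rw [indicator_of_notMem (by exact hw0), indicator_of_notMem (by exact fun h => hw0 h.1)]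

theorem measure_eigMin_nonpos (hpos : ∀ i j, 0 < φ i j)
    (hlaw : ∀ i j, HasLaw (fun ω => H ω i j) (complexGaussian (φ i j)) P)
    (hindep : iIndepFun (fun (p : Fin 2 × Fin 2) (ω : Ω) => H ω p.1 p.2) P)
    (h21 : φ 1 0 = v) (h22 : φ 1 1 = v) (hne : φ 0 0 ≠ φ 0 1) :
    P {ω | eigMin (H ω) ≤ 0} = 0 := by
  have hS : MeasurableSet {p : ℝ × ℝ | p.2 ≤ 0} := measurableSet_le measurable_snd measurable_const
  refine (measure_eigenvalues_mem hpos hlaw hindep h21 h22 hne hS).trans ?_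
  refine setLIntegral_eq_zero measurableSet_Ioi fun w _ => ?_
  refine setLIntegral_eq_zero measurableSet_Ioi fun x _ => ?_
  refine setLIntegral_eq_zero measurableSet_Ioo fun y hy => ?_
  rw [indicator_of_notMem (by exact fun h : y ≤ 0 => hy.1.not_ge h)]
  rfl

end Distribution

/-- Passing from entire functions back to `Ei`: the constants `eiConst` and the terms `log x`
cancel, and the remaining logarithms combine into `log |(φ₃ - φ₂) / (φ₃ - φ₁)|`. -/
theorem eigMaxCDF_eq {φ₁ φ₂ φ₃ x : ℝ} (hp1 : 0 < φ₁) (hp2 : 0 < φ₂) (hp3 : 0 < φ₃)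
    (h1 : φ₃ ≠ φ₁) (h2 : φ₃ ≠ φ₂) (hx : 0 < x) :
    eigMaxCDF φ₁ φ₂ φ₃ x = 1 / (φ₂ - φ₁) *
      ((1 - Real.exp (-x / φ₃)) *
          (φ₂ * (1 - Real.exp (-x / φ₂)) - φ₁ * (1 - Real.exp (-x / φ₁))) +
        x * Real.exp (-x / φ₃) *
          (-gFun φ₁ φ₂ φ₃ x + Ei (-x / φ₂) - Ei (-x / φ₁) +
            Real.log |(φ₃ - φ₂) / (φ₃ - φ₁)|)) := by
  have key : ∀ φ : ℝ, 0 < φ → φ₃ ≠ φ →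
      Ei ((1 / φ₃ - 1 / φ) * x) - eiEntire ((1 / φ₃ - 1 / φ) * x) =
        eiConst + Real.log (φ₃ - φ) - Real.log φ₃ - Real.log φ + Real.log x ∧
      Ei (-x / φ) - eiEntire (-x / φ) = eiConst + Real.log x - Real.log φ := by
    intro φ hφ hne
    have hs : φ₃ - φ ≠ 0 := sub_ne_zero.2 hne
    have ha : 1 / φ₃ - 1 / φ = -((φ₃ - φ) / (φ₃ * φ)) := by
      field_simp
      ring
    have ha0 : 1 / φ₃ - 1 / φ ≠ 0 := by
      rw [ha]
      exact neg_ne_zero.2 (div_ne_zero hs (by positivity))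
    constructor
    · rw [Ei_eq (mul_ne_zero ha0 hx.ne'), Real.log_mul ha0 hx.ne', ha, Real.log_neg_eq_log,
        Real.log_div hs (by positivity), Real.log_mul hp3.ne' hφ.ne']
      ring
    · rw [Ei_eq (div_ne_zero (neg_ne_zero.2 hx.ne') hφ.ne'), neg_div, Real.log_neg_eq_log,
        Real.log_div hx.ne' hφ.ne']
      ring
  have hs1 : φ₃ - φ₁ ≠ 0 := sub_ne_zero.2 h1
  have hs2 : φ₃ - φ₂ ≠ 0 := sub_ne_zero.2 h2
  obtain ⟨k1, k1'⟩ := key φ₁ hp1 h1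
  obtain ⟨k2, k2'⟩ := key φ₂ hp2 h2
  rw [eigMaxCDF, gEntire, gFun, Real.log_abs, Real.log_div hs2 hs1]
  congr 3
  linarith

theorem corollary1 {Ω : Type*} [MeasurableSpace Ω] (P : Measure Ω) [IsProbabilityMeasure P]
    (H : Ω → Matrix (Fin 2) (Fin 2) ℂ) (φ : Fin 2 → Fin 2 → ℝ) (φ₁ φ₂ φ₃ : ℝ)
    (hpos : ∀ i j, 0 < φ i j)
    (hlaw : ∀ i j, HasLaw (fun ω => H ω i j) (complexGaussian (φ i j)) P)
    (hindep : iIndepFun (fun (p : Fin 2 × Fin 2) (ω : Ω) => H ω p.1 p.2) P)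
    (h21 : φ 1 0 = φ₃) (h22 : φ 1 1 = φ₃)
    (h1 : φ₁ = min (φ 0 0) (φ 0 1)) (h2 : φ₂ = max (φ 0 0) (φ 0 1)) (h12 : φ₁ ≠ φ₂) :
    -- the density of the Gram matrix
    HasDensity (fun ω => gram (H ω)) P hermitianVolume (gramDensity φ) ∧
    -- the joint density of the ordered eigenvalues
    (φ₃ ≠ φ₁ → φ₃ ≠ φ₂ →
      HasDensity (fun ω => (eigMax (H ω), eigMin (H ω))) P volume
        (eigDensity φ₁ φ₂ φ₃ (detG φ₁ φ₂ φ₃))) ∧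
    -- the same with the second determinant read by continuity in `φ₃`,
    -- which covers `φ₃ = φ₁` and `φ₃ = φ₂`, where `g` itself is not defined
    (∃ D : (Fin 2 → ℝ) → ℝ,
      (∀ l : Fin 2 → ℝ, l 1 ≤ l 0 → 0 < l 1 →
        Tendsto (fun r => detG φ₁ φ₂ r l) (𝓝[({φ₁, φ₂} : Set ℝ)ᶜ] φ₃) (𝓝 (D l))) ∧
      HasDensity (fun ω => (eigMax (H ω), eigMin (H ω))) P volume
        (eigDensity φ₁ φ₂ φ₃ D)) ∧
    -- the distribution functions of the extreme eigenvalues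
    (φ₃ ≠ φ₁ → φ₃ ≠ φ₂ → ∀ x : ℝ,
      (x ≤ 0 → P.real {ω | eigMin (H ω) ≤ x} = 0 ∧ P.real {ω | eigMax (H ω) ≤ x} = 0) ∧
      (0 < x →
        P.real {ω | eigMin (H ω) ≤ x} =
          1 - Real.exp (-x / φ₃) / (φ₂ - φ₁) *
            (φ₂ * Real.exp (-x / φ₂) - φ₁ * Real.exp (-x / φ₁) +
              x * (Ei (-x / φ₂) - Ei (-x / φ₁))) ∧
        P.real {ω | eigMax (H ω) ≤ x} =
          1 / (φ₂ - φ₁) *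
            ((1 - Real.exp (-x / φ₃)) *
                (φ₂ * (1 - Real.exp (-x / φ₂)) - φ₁ * (1 - Real.exp (-x / φ₁))) +
              x * Real.exp (-x / φ₃) *
                (-gFun φ₁ φ₂ φ₃ x + Ei (-x / φ₂) - Ei (-x / φ₁) +
                  Real.log |(φ₃ - φ₂) / (φ₃ - φ₁)|)))) := by
  -- all formulas are symmetric in the two variances of the first row, so their order is immaterial
  have hcase : (φ 0 0 = φ₁ ∧ φ 0 1 = φ₂) ∨ (φ 0 0 = φ₂ ∧ φ 0 1 = φ₁) := by
    rcases le_total (φ 0 0) (φ 0 1) with h | h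
    · exact Or.inl ⟨by rw [h1, min_eq_left h], by rw [h2, max_eq_right h]⟩
    · exact Or.inr ⟨by rw [h2, max_eq_left h], by rw [h1, min_eq_right h]⟩
  have hne : φ 0 0 ≠ φ 0 1 := by
    rcases hcase with ⟨ha, hb⟩ | ⟨ha, hb⟩ <;> rw [ha, hb]
    exacts [h12, h12.symm]
  have hp3 : 0 < φ₃ := h21 ▸ hpos 1 0
  have hp1 : 0 < φ₁ := h1 ▸ lt_min (hpos 0 0) (hpos 0 1)
  have hp2 : 0 < φ₂ := h2 ▸ lt_max_of_lt_left (hpos 0 0)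
  have hdens : HasDensity (fun ω => (eigMax (H ω), eigMin (H ω))) P volume
      (orderedEigenvalueDensity φ₁ φ₂ φ₃) := by
    have h := hasDensity_eigenvalues hpos hlaw hindep h21 h22 hne
    rcases hcase with ⟨ha, hb⟩ | ⟨ha, hb⟩ <;> rw [ha, hb] at h
    exacts [h, orderedEigenvalueDensity_swap φ₁ φ₂ φ₃ ▸ h]
  refine ⟨hasDensity_gram hpos hlaw hindep h21 h22 hne, fun h31 h32 => ?_,
    ⟨_, fun l h01 hl => tendsto_detG hp3.ne' h01 hl, hdens⟩, fun h31 h32 x => ⟨fun hx => ?_,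
      fun hx => ⟨?_, ?_⟩⟩⟩
  · rw [eigDensity_detG h31 h32]
    exact hdens
  · have h0 := measure_eigMin_nonpos hpos hlaw hindep h21 h22 hne
    have hmin : P {ω | eigMin (H ω) ≤ x} = 0 :=
      measure_mono_null (fun ω (h : eigMin (H ω) ≤ x) => h.trans hx) h0
    have hmax : P {ω | eigMax (H ω) ≤ x} = 0 :=
      measure_mono_null (fun ω (h : eigMax (H ω) ≤ x) => min_le_max.trans h) hmin
    simp [measureReal_def, hmin, hmax]
  · have hm : AEMeasurable (fun ω => eigMin (H ω)) P :=
      (aemeasurable_eigenvalues fun i j => (hlaw i j).aemeasurable).snd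
    have hc : {ω | eigMin (H ω) ≤ x} = {ω | x < eigMin (H ω)}ᶜ := by
      ext ω
      simp
    have htail := measure_lt_eigMin hpos hlaw hindep h21 h22 hne hx
    have hnn := (setLIntegral_eigMinTail (v := φ₃) (hpos 0 0) (hpos 0 1) hne hx).1
    have he : eigMinTail (φ 0 0) (φ 0 1) φ₃ x = eigMinTail φ₁ φ₂ φ₃ x := by
      rcases hcase with ⟨ha, hb⟩ | ⟨ha, hb⟩ <;> rw [ha, hb]
      exact eigMinTail_swap _ _ _ _
    have hms : NullMeasurableSet {ω | x < eigMin (H ω)} P :=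
      hm.nullMeasurableSet_preimage measurableSet_Ioi
    rw [hc, probReal_compl_eq_one_sub₀ hms, measureReal_def, htail, ENNReal.toReal_ofReal hnn, he]
    rfl
  · have he : eigMaxCDF (φ 0 0) (φ 0 1) φ₃ x = eigMaxCDF φ₁ φ₂ φ₃ x := by
      rcases hcase with ⟨ha, hb⟩ | ⟨ha, hb⟩ <;> rw [ha, hb]
      exact eigMaxCDF_swap _ _ _ _
    rw [measureReal_def, measure_eigMax_le hpos hlaw hindep h21 h22 hne hx, ENNReal.toReal_ofReal
      (setLIntegral_eigMaxCDF (hpos 0 0) (hpos 0 1) hne hp3 hx).1, he]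
    exact eigMaxCDF_eq hp1 hp2 hp3 h31 h32 hx
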